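/- **Setting.** Let $L\ge 1$ and let $\log$ be the natural logarithm. For each local node $l=1,\dots,L$ let $f_{0,l},f_{1,l}$ be probability densities on a measurable space $\mathcal X_l$ with respect to a $\sigma$-finite measure, let $q_l$ be a measurable quantizer from $\mathcal X_l$ to a countable alphabet $A_l$, let $\Delta_l>0$ (the quantization step), and let $L_{n,l}$, $n\ge 0$, be the codelength function (in nats) of a lossless binary source code for words of length $n$ over $A_l$. (For a finite alphabet: counting measure, $q_l=\mathrm{id}$, $\Delta_l=1$. For a continuous alphabet: Lebesgue measure and the uniform quantizer with step $\Delta_l$.) Let $\lambda>0$ and $\lambda\le D(f_{1,l}\|f_{0,l})<\infty$ for all $l$. Put $$D_{tot}^0=\frac{L\lambda}{2},\quad D_{tot}^1=\sum_{l=1}^L\Big(D(f_{1,l}\|f_{0,l})-\frac\lambda2\Big),\quad r_l=\frac{\lambda/2}{D^0_{tot}},\quad \rho_l=\frac{D(f_{1,l}\|f_{0,l})-\lambda/2}{D^1_{tot}} .$$ Under $H_i$ ($i\in\{0,1\}$, probability $P_i$, expectation $E_i$) the observations $X_{k,l}$ ($k\ge1$, $1\le l\le L$) have density $f_{i,l}$,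 the noise variables $Z_k$ ($k\ge1$) have a density $g$ on $\mathbb R$, and all these variables are independent. **Test.** Node $l$ computes $$\widehat W_{n,l}=-L_{n,l}\big(q_l(X_{1,l}),\dots,q_l(X_{n,l})\big)-n\log\Delta_l-\sum_{k=1}^n\log f_{0,l}(X_{k,l})-n\frac\lambda2$$ and at each time $n\ge1$ transmits $Y_{n,l}=b_1\mathbf 1\{\widehat W_{n,l}\ge\rho_l|\log c|\}+b_0\mathbf 1\{\widehat W_{n,l}\le -r_l|\log c|\}$, where $b_0,b_1\in\mathbb R$. The fusion center receives $Y_n=\sum_{l=1}^LY_{n,l}+Z_n$, computes $F_n=\sum_{k=1}^n\xi(Y_k)$, where $\xi(y)=\log\frac{g(y-\mu_1)}{g(y+\mu_0)}$ with $\mu_0,\mu_1\in\mathbb R$, and stops at $N_d=\inf\{n:F_n\notin(-|\log c|,|\log c|)\}$. (The logarithm of a ratio whose numerator or denominator is $0$ is read as $0$; this only matters where a density vanishes.) **Notation.** Let $Z$ have density $g$. Let $\Delta(\mathcal A^i)=E[\xi(Lb_i+Z)]$ be the drift of $F$ when all nodes transmit $b_i$. Let $\xi_1^*=\xi(Lb_{1-i}+Z)$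 under $H_i$ be the increment of $F$ when all nodes transmit the wrong decision, and $\theta_i=E_i[\xi_1^*]$. Let $$N_{i,l}^*(\epsilon)=\sup\Big\{n\ge1:\Big|-L_{n,l}\big(q_l(X_{1,l}),\dots,q_l(X_{n,l})\big)-n\log\Delta_l-\sum_{k=1}^n\log f_{i,l}(X_{k,l})\Big|>n\epsilon\Big\}\qquad(\sup\emptyset=0).$$ **Theorem.** Fix $i\in\{0,1\}$. Suppose that $\xi(jb_1+kb_0+Z)$ is integrable for all integers $j,k\ge0$ with $j+k\le L$, and that the wrong decisions are the worst case for the mean increment under $H_i$, that is, for all such $j,k$, $E[\xi(jb_1+kb_0+Z)]\le\theta_0$ if $i=0$, and $E[\xi(jb_1+kb_0+Z)]\ge\theta_1$ if $i=1$. Suppose that $\Delta(\mathcal A^0)<0$ if $i=0$, and $\Delta(\mathcal A^1)>0$ if $i=1$. Assume that for some $\alpha>1$: (i) $E_i[N_{i,l}^*(\epsilon)]<\infty$ for every $\epsilon>0$ and every $l$; (ii) $E_i\Big[\Big|\log\frac{f_{1,l}(X_{1,l})}{f_{0,l}(X_{1,l})}\Big|^{\alpha+1}\Big]<\infty$ for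 every $l$; (iii) $E_i[|\xi_1^*|^{\alpha+1}]<\infty$. Then, under $H_i$, $$\limsup_{c\downarrow0}\frac{N_d}{|\log c|}\le\frac1{D_{tot}^i}+M_i\ \text{ almost surely},\qquad \limsup_{c\downarrow0}\frac{E_i[N_d]}{|\log c|}\le\frac1{D_{tot}^i}+M_i,$$ where $M_i=C_i/\Delta(\mathcal A^i)$, $C_0=-\Big[1+\frac{E_0|\xi_1^*|}{D_{tot}^0}\Big]$ and $C_1=1+\frac{E_1|\xi_1^*|}{D_{tot}^1}$. -/

import Mathlib

open MeasureTheory ProbabilityTheory Filter Topology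
open scoped ENNReal

noncomputable section

/-- A lossless (variable-length, binary) source code for words over the alphabet `A`: for every
block length `n` an injective map from words of length `n` to bit strings. -/
structure LosslessCode (A : Type*) where
  encode : (n : ℕ) → (Fin n → A) → List Bool
  injective : ∀ n, Function.Injective (encode n)

/-- The codelength function `L_n`, measured in nats (all logarithms below are natural). -/
def LosslessCode.codeLength {A : Type*} (C : LosslessCode A) (n : ℕ) (x : Fin n → A) : ℝ :=
  Real.log 2 * ((C.encode n x).length : ℝ)

/-- The data of a local node: the densities `f 0`, `f 1` of one observation under the two
hypotheses, with respect to a reference measure `ref`; a quantizer onto a countable alphabet, with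
quantization step `step`; and the source code that is run on the quantized observations.
Continuous alphabet: `𝒳 = ℝ`, `ref` is Lebesgue measure, `quantize` is a uniform quantizer with
step `step`. Finite alphabet: `𝒳 = A`, `ref` is counting measure, `quantize = id`, `step = 1`. -/
structure LocalNode (𝒳 A : Type*) [MeasurableSpace 𝒳] [MeasurableSpace A] where
  ref : Measure 𝒳
  ref_sigmaFinite : SigmaFinite ref
  f : Fin 2 → 𝒳 → ℝ
  f_measurable : ∀ i, Measurable (f i)
  f_nonneg : ∀ i x, 0 ≤ f i x
  f_lintegral : ∀ i, ∫⁻ x, ENNReal.ofReal (f i x) ∂ref = 1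
  quantize : 𝒳 → A
  quantize_measurable : Measurable quantize
  step : ℝ
  step_pos : 0 < step
  code : LosslessCode A

namespace LocalNode

variable {𝒳 A : Type*} [MeasurableSpace 𝒳] [MeasurableSpace A]

/-- The law of one observation under `H_i`. -/
def law (N : LocalNode 𝒳 A) (i : Fin 2) : Measure 𝒳 :=
  N.ref.withDensity (fun x => ENNReal.ofReal (N.f i x))

/-- The Kullback-Leibler divergence `D(f_1 || f_0)`, possibly infinite. -/
def divergence (N : LocalNode 𝒳 A) : ℝ≥0∞ :=
  InformationTheory.klDiv (N.law 1) (N.law 0)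

/-- `-L_n(x_1^n) - n log(step) - log f_i(x_1^n)`. Here and below `x k` is the observation
at time `k + 1`. -/
def codingError (N : LocalNode 𝒳 A) (i : Fin 2) (n : ℕ) (x : ℕ → 𝒳) : ℝ :=
  -N.code.codeLength n (fun k : Fin n => N.quantize (x k)) - n * Real.log N.step
    - ∑ k ∈ Finset.range n, Real.log (N.f i (x k))

/-- The local universal test statistic
`-L_n(x_1^n) - n log(step) - log f_0(x_1^n) - n lam / 2`. -/
def statistic (N : LocalNode 𝒳 A) (lam : ℝ) (n : ℕ) (x : ℕ → 𝒳) : ℝ :=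
  N.codingError 0 n x - n * (lam / 2)

/-- `N_i^*(ε)`, the last time `n ≥ 1` at which
`|-L_n(x_1^n) - n log(step) - log f_i(x_1^n)| > n ε` (the value is `0` if there is no such time,
and `∞` if there are infinitely many). -/
def lastDeviation (N : LocalNode 𝒳 A) (i : Fin 2) (ε : ℝ) (x : ℕ → 𝒳) : ℕ∞ :=
  ⨆ (n : ℕ) (_ : 1 ≤ n ∧ n * ε < |N.codingError i n x|), (n : ℕ∞)

end LocalNode

/-- The data of the channel and the fusion center: the density `g` of the noise of the
multiple-access channel, the value `b i` that a local node transmits when it decides for `H_i`, and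
the parameters `μ₁`, `μ₀` of the test at the fusion center. -/
structure FusionCenter where
  g : ℝ → ℝ
  g_measurable : Measurable g
  g_nonneg : ∀ z, 0 ≤ g z
  g_lintegral : ∫⁻ z, ENNReal.ofReal (g z) = 1
  b : Fin 2 → ℝ
  μ₁ : ℝ
  μ₀ : ℝ

namespace FusionCenter

/-- The law of the noise. -/
def noise (fc : FusionCenter) : Measure ℝ :=
  volume.withDensity (fun z => ENNReal.ofReal (fc.g z))

/-- `log (g_{μ₁}(y) / g_{-μ₀}(y))`, where `g_m` is the density of `Z + m`. -/
def llr (fc : FusionCenter) (y : ℝ) : ℝ :=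
  Real.log (fc.g (y - fc.μ₁) / fc.g (y + fc.μ₀))

/-- The mean increment of the fusion center statistic when the local transmissions add up
to `s`. -/
def meanIncrement (fc : FusionCenter) (s : ℝ) : ℝ := ∫ z, fc.llr (s + z) ∂fc.noise

/-- `Δ(𝒜^i)`: the drift of the fusion center statistic when all `L` nodes transmit `b i`. -/
def drift (fc : FusionCenter) (L : ℕ) (i : Fin 2) : ℝ := fc.meanIncrement (L * fc.b i)

/-- The increment `ξ^*` under `H_i`, as a function of the noise: all `L` nodes transmit the wrong
decision `b (1 - i)`. -/
def wrongIncrement (fc : FusionCenter) (L : ℕ) (i : Fin 2) (z : ℝ) : ℝ :=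
  fc.llr (L * fc.b (1 - i) + z)

/-- `θ_i`, the mean of `ξ^*` under `H_i`. -/
def wrongDrift (fc : FusionCenter) (L : ℕ) (i : Fin 2) : ℝ :=
  ∫ z, fc.wrongIncrement L i z ∂fc.noise

/-- Wrong decisions of all nodes are the worst case for the mean increment under `H_i`: whenever
`j` of the `L` nodes transmit `b 1`, `k` transmit `b 0` and the others are silent, the mean
increment is at most `θ_0` (for `i = 0`), respectively at least `θ_1` (for `i = 1`). -/
def WrongIsWorst (fc : FusionCenter) (L : ℕ) (i : Fin 2) : Prop :=
  ∀ j k : ℕ, j + k ≤ L →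
    (i = 0 → fc.meanIncrement (j * fc.b 1 + k * fc.b 0) ≤ fc.wrongDrift L i) ∧
    (i = 1 → fc.wrongDrift L i ≤ fc.meanIncrement (j * fc.b 1 + k * fc.b 0))

end FusionCenter

namespace DecentralizedTest

variable {L : ℕ} {𝒳 A : Fin L → Type*} [∀ l, MeasurableSpace (𝒳 l)] [∀ l, MeasurableSpace (A l)]

/-- `D_tot^0 = L lam / 2` and `D_tot^1 = ∑ l, (D(f_{1,l} || f_{0,l}) - lam / 2)`. -/
def Dtot (node : (l : Fin L) → LocalNode (𝒳 l) (A l)) (lam : ℝ) (i : Fin 2) : ℝ :=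
  if i = 0 then L * lam / 2 else ∑ l, ((node l).divergence.toReal - lam / 2)

/-- The lower local threshold `-r_l |log c|`, with `r_l = (lam / 2) / D_tot^0`. -/
def lowerThreshold (node : (l : Fin L) → LocalNode (𝒳 l) (A l)) (lam c : ℝ) : ℝ :=
  -(lam / 2 / Dtot node lam 0 * |Real.log c|)

/-- The upper local threshold `ρ_l |log c|`, with
`ρ_l = (D(f_{1,l} || f_{0,l}) - lam / 2) / D_tot^1`. -/
def upperThreshold (node : (l : Fin L) → LocalNode (𝒳 l) (A l)) (lam c : ℝ) (l : Fin L) : ℝ :=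
  ((node l).divergence.toReal - lam / 2) / Dtot node lam 1 * |Real.log c|

open Classical in
/-- What node `l` transmits at time `n`, given its observations `x`. -/
def transmission (node : (l : Fin L) → LocalNode (𝒳 l) (A l)) (fc : FusionCenter) (lam c : ℝ)
    (l : Fin L) (n : ℕ) (x : ℕ → 𝒳 l) : ℝ :=
  (if upperThreshold node lam c l ≤ (node l).statistic lam n x then fc.b 1 else 0)
    + (if (node l).statistic lam n x ≤ lowerThreshold node lam c then fc.b 0 else 0)

/-- What the fusion center receives at time `n + 1`; `z n` is the noise at time `n + 1`. -/
def received (node : (l : Fin L) → LocalNode (𝒳 l) (A l)) (fc : FusionCenter) (lam c : ℝ)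
    (x : (l : Fin L) → ℕ → 𝒳 l) (z : ℕ → ℝ) (n : ℕ) : ℝ :=
  ∑ l, transmission node fc lam c l (n + 1) (x l) + z n

/-- The fusion center statistic `F_n`, the sum of the first `n` log-likelihood ratios. -/
def fcStatistic (node : (l : Fin L) → LocalNode (𝒳 l) (A l)) (fc : FusionCenter) (lam c : ℝ)
    (x : (l : Fin L) → ℕ → 𝒳 l) (z : ℕ → ℝ) (n : ℕ) : ℝ :=
  ∑ k ∈ Finset.range n, fc.llr (received node fc lam c x z k)

/-- `N_d`, the first time at which the fusion center statistic leaves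
`(-|log c|, |log c|)` (`∞` if it never does). -/
def stoppingTime (node : (l : Fin L) → LocalNode (𝒳 l) (A l)) (fc : FusionCenter) (lam c : ℝ)
    (x : (l : Fin L) → ℕ → 𝒳 l) (z : ℕ → ℝ) : ℕ∞ :=
  ⨅ (n : ℕ) (_ : fcStatistic node fc lam c x z n ∉ Set.Ioo (-|Real.log c|) |Real.log c|),
    (n : ℕ∞)

/-- The hypothesis `H_i` holds under the probability measure `P`: the observations `X l k` have the
density `f i` of node `l`, the noise variables `Z k` have density `g`, and all of them are
independent. -/
structure Model (node : (l : Fin L) → LocalNode (𝒳 l) (A l)) (fc : FusionCenter) (i : Fin 2)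
    {Ω : Type*} [MeasurableSpace Ω] (P : Measure Ω)
    (X : (l : Fin L) → ℕ → Ω → 𝒳 l) (Z : ℕ → Ω → ℝ) : Prop where
  measurable_X : ∀ l k, Measurable (X l k)
  measurable_Z : ∀ k, Measurable (Z k)
  law_X : ∀ l k, P.map (X l k) = (node l).law i
  law_Z : ∀ k, P.map (Z k) = fc.noise
  indep_X : iIndepFun (fun p : Fin L × ℕ => X p.1 p.2) P
  indep_Z : iIndepFun Z P
  indep_XZ : IndepFun (fun ω (p : Fin L × ℕ) => X p.1 p.2 ω) (fun ω k => Z k ω) P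

/-- `C_0 = -(1 + E_0|ξ^*| / D_tot^0)` and `C_1 = 1 + E_1|ξ^*| / D_tot^1`. -/
def C (node : (l : Fin L) → LocalNode (𝒳 l) (A l)) (fc : FusionCenter) (lam : ℝ) (i : Fin 2) : ℝ :=
  (if i = 0 then -1 else 1) *
    (1 + (∫ z, |fc.wrongIncrement L i z| ∂fc.noise) / Dtot node lam i)

/-- The bound `1 / D_tot^i + M_i`, with `M_i = C_i / Δ(𝒜^i)`. -/
def bound (node : (l : Fin L) → LocalNode (𝒳 l) (A l)) (fc : FusionCenter) (lam : ℝ) (i : Fin 2) :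
    ℝ :=
  1 / Dtot node lam i + C node fc lam i / fc.drift L i

end DecentralizedTest

end

/-! Put a = |log c|, D = D_tot^i, θ = E_i|ξ^*|, and let Δ > 0 be Δ(𝒜^i) times `hypSign i`; with this
sign the two hypotheses are treated alike. Under H_i the signed statistic of node l grows like n
times `nodeDrift`: the coding error is o(n), and for i = 1 the log-likelihood ratios obey the law of
large numbers. The threshold for the correct decision is `nodeDrift` · a / D, so all nodes cross at
about the same time a / D; they are silent shortly before and all send b_i afterwards. Up to a / D
the fusion walk loses at most about θa / D, because the wrong decisions are the worst case. It then
climbs with drift Δ and needs about (a + θa / D) / Δ further steps. The total is a times `bound`.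

Almost surely, `eventually_le_sum_floor` makes this precise through the law of large numbers for the
noise with inputs 0 and L b_i; the loss in a window around a / D vanishes with its relative width.

In mean, the argument is of Wald type (`sum_measureReal_belowEvent_le`). The increments are
truncated from above at K, so the stopped walk is at most a + K, while each step before stopping has
mean at least about Δ if all nodes are right and at least about -θ otherwise. If Q bounds the
expected number of times at which not all nodes are right, the mean passage time is at most about (a
+ K + (Δ + θ)Q) / Δ. By `exists_sum_measureReal_transmission_le`, Q can be (1 + η)a / D + O(1):
coding deviations are counted by the last deviation time, and those of the log-likelihood ratio are
summable by Chernoff, as exp(-log(f_1 / f_0)) is integrable under f_1. The leading term is again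
`bound`. -/

/-! ### Independence of the present noise from the past -/

/-- If `U` is independent of `(V, W)` and `V` is independent of `W`, then `(U, V)` is independent
of `W`. -/
theorem indepFun_prodMk_of_indepFun {Ω α β γ : Type*} [MeasurableSpace Ω] [MeasurableSpace α]
    [MeasurableSpace β] [MeasurableSpace γ] {P : Measure Ω} [IsProbabilityMeasure P]
    {U : Ω → α} {V : Ω → β} {W : Ω → γ} (hU : Measurable U) (hV : Measurable V)
    (hW : Measurable W) (h : IndepFun U (fun ω => (V ω, W ω)) P) (hVW : IndepFun V W P) :
    IndepFun (fun ω => (U ω, V ω)) W P := by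
  have hUV : IndepFun U V P := h.comp measurable_id measurable_fst
  rw [indepFun_iff_map_prod_eq_prod_map_map (by fun_prop) (by fun_prop)] at h hVW hUV ⊢
  have := Measure.isProbabilityMeasure_map (μ := P) hU.aemeasurable
  have := Measure.isProbabilityMeasure_map (μ := P) hV.aemeasurable
  have := Measure.isProbabilityMeasure_map (μ := P) hW.aemeasurable
  rw [hUV]
  apply MeasurableEquiv.prodAssoc.map_measurableEquiv_injective
  rw [Measure.prodAssoc_prod, ← hVW, ← h, Measure.map_map (by fun_prop) (by fun_prop)]
  rfl

/-- `U` together with `Z 0, …, Z (k - 1)` is independent of `Z k`. -/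
theorem indepFun_past {Ω E : Type*} [MeasurableSpace Ω] [MeasurableSpace E] {P : Measure Ω}
    [IsProbabilityMeasure P] {U : Ω → E} {Z : ℕ → Ω → ℝ} (hU : Measurable U)
    (hZ : ∀ k, Measurable (Z k)) (hind : iIndepFun Z P)
    (hUZ : IndepFun U (fun ω k => Z k ω) P) (k : ℕ) :
    IndepFun (fun ω => (U ω, fun j : Finset.range k => Z j ω)) (Z k) P := by
  refine indepFun_prodMk_of_indepFun hU (by fun_prop) (hZ k) ?_ ?_
  · exact hUZ.comp measurable_id
      (ψ := fun z : ℕ → ℝ => ((fun j : Finset.range k => z j), z k)) (by fun_prop)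
  · have := hind.indepFun_finset (Finset.range k) {k} (by simp) hZ
    exact this.comp measurable_id
      (ψ := fun z : ({k} : Finset ℕ) → ℝ => z ⟨k, by simp⟩) (by fun_prop)

/-! ### Mean passage time of a modulated walk -/

/-- A sum of steps that are at most `K`, stopped when it reaches the level `a`, is at most
`a + K`. -/
theorem sum_stopped_le {x : ℕ → ℝ} {a K : ℝ} (ha : 0 ≤ a) (hK : 0 ≤ K) (hx : ∀ k, x k ≤ K)
    (p : ℕ → Prop) [DecidablePred p]
    (hp : ∀ k, p k ↔ ∀ j ≤ k, ∑ i ∈ Finset.range j, x i < a) (n : ℕ) :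
    ∑ k ∈ Finset.range n, (if p k then x k else 0) ≤ a + K := by
  induction n with
  | zero => simpa using add_nonneg ha hK
  | succ n ih =>
    rw [Finset.sum_range_succ]
    by_cases hn : p n
    · have hlt := (hp n).1 hn n le_rfl
      -- `p` can only switch from true to false, so while it holds the stopped sum is the full sum,
      -- still below `a`.
      have : ∑ k ∈ Finset.range n, (if p k then x k else 0) = ∑ k ∈ Finset.range n, x k := by
        refine Finset.sum_congr rfl fun k hk => if_pos ?_
        exact (hp k).2 fun j hj => (hp n).1 hn j (hj.trans (Finset.mem_range.1 hk).le)
      rw [this, if_pos hn]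
      linarith [hx n]
    · simpa [hn] using ih

/-- The event that the random walk with steps `φ (T k + Z k)` stays below `a` up to time `k`. -/
def belowEvent {Ω : Type*} (φ : ℝ → ℝ) (T Z : ℕ → Ω → ℝ) (a : ℝ) (k : ℕ) : Set Ω :=
  {ω | ∀ j ≤ k, ∑ i ∈ Finset.range j, φ (T i ω + Z i ω) < a}

/-- A bound on the expected passage time of a random walk whose steps `φ (T k + Z k)` are modulated
by a process `T` that is independent of `Z`, takes values in a finite set, and is mostly equal
to `s₀`. -/
theorem sum_measureReal_belowEvent_le {Ω E : Type*} [MeasurableSpace Ω] [mE : MeasurableSpace E]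
    {P : Measure Ω} [IsProbabilityMeasure P] {U : Ω → E} {T Z : ℕ → Ω → ℝ} (hU : Measurable U)
    (hZ : ∀ k, Measurable (Z k)) (hind : iIndepFun Z P)
    (hUZ : IndepFun U (fun ω k => Z k ω) P) {ν : Measure ℝ} (hlaw : ∀ k, P.map (Z k) = ν)
    (hT : ∀ k, Measurable[mE.comap U] (T k)) {S : Finset ℝ} (hTS : ∀ k ω, T k ω ∈ S)
    {φ : ℝ → ℝ} (hφ : Measurable φ) (hint : ∀ s ∈ S, Integrable (fun z => φ (s + z)) ν)
    {a K d θ s₀ : ℝ} (ha : 0 ≤ a) (hK : 0 ≤ K) (hφK : ∀ y, φ y ≤ K)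
    (hθ : ∀ s ∈ S, -θ ≤ ∫ z, φ (s + z) ∂ν) (hd : d ≤ ∫ z, φ (s₀ + z) ∂ν) (n : ℕ) :
    d * ∑ k ∈ Finset.range n, P.real (belowEvent φ T Z a k) ≤
      a + K + |d + θ| * ∑ k ∈ Finset.range n, P.real {ω | T k ω ≠ s₀} := by
  classical
  have hTm : ∀ k, Measurable (T k) := fun k => (hT k).mono hU.comap_le le_rfl
  -- `m k` contains all of `U`, its future included. This costs nothing, as `U` is independent of
  -- the noise, and it makes every `T i` measurable. `belowEvent` at `k` involves only `Z i` with `i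
  -- < k`, hence lies in `m k`, which is independent of `Z k`.
  let m : ℕ → MeasurableSpace Ω := fun k =>
    MeasurableSpace.comap (fun ω => (U ω, fun j : Finset.range k => Z j ω)) inferInstance
  have hpair : ∀ k, Measurable (fun ω => (U ω, fun j : Finset.range k => Z j ω)) :=
    fun k => by fun_prop
  have hm : ∀ k, m k ≤ ‹MeasurableSpace Ω› := fun k => (hpair k).comap_le
  have hTk : ∀ k i, Measurable[m k] (T i) := fun k i => by
    refine (hT i).mono ?_ le_rfl
    have : Measurable[m k] U :=
      measurable_fst.comp (comap_measurable (fun ω => (U ω, fun j : Finset.range k => Z j ω)))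
    exact this.comap_le
  have hZk : ∀ k, ∀ i < k, Measurable[m k] (Z i) := fun k i hi =>
    ((measurable_pi_apply (⟨i, Finset.mem_range.2 hi⟩ : Finset.range k)).comp
      measurable_snd).comp (comap_measurable (fun ω => (U ω, fun j : Finset.range k => Z j ω)))
  have hA : ∀ k, MeasurableSet[m k] (belowEvent φ T Z a k) := fun k => by
    have : belowEvent φ T Z a k =
        ⋂ j ∈ Finset.range (k + 1), {ω | ∑ i ∈ Finset.range j, φ (T i ω + Z i ω) < a} := by
      ext ω; simp [belowEvent]
    rw [this]
    refine Finset.measurableSet_biInter _ fun j hj => ?_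
    have hj' : j ≤ k := Nat.lt_succ_iff.1 (Finset.mem_range.1 hj)
    have hsum : Measurable[m k] (fun ω => ∑ i ∈ Finset.range j, φ (T i ω + Z i ω)) :=
      Finset.measurable_fun_sum _ fun i hi => hφ.comp
        ((hTk k i).add (hZk k i ((Finset.mem_range.1 hi).trans_le hj')))
    exact hsum measurableSet_Iio
  have hA' : ∀ k, MeasurableSet (belowEvent φ T Z a k) := fun k => hm k _ (hA k)
  have hTs : ∀ k i s, MeasurableSet[m k] {ω | T i ω = s} := fun k i s =>
    (hTk k i) (measurableSet_singleton s)
  have hintZ : ∀ k, ∀ s ∈ S, Integrable (fun ω => φ (s + Z k ω)) P := fun k s hs => by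
    have := hint s hs
    rw [← hlaw k] at this
    exact this.comp_measurable (hZ k)
  have hindep : ∀ k, ∀ B, MeasurableSet[m k] B → ∀ s,
      ∫ ω in B, φ (s + Z k ω) ∂P = P.real B * ∫ z, φ (s + z) ∂ν := fun k B hB s => by
    have h1 := Indep.setIntegral_eq_mul (P := P) (hm k) (X := Z k) (f := fun z => φ (s + z))
      (indepFun_past hU hZ hind hUZ k) (hZ k).aemeasurable hB
      (hφ.comp (measurable_const_add s)).aestronglyMeasurable
    rw [h1, ← hlaw k, integral_map (f := fun z => φ (s + z)) (hZ k).aemeasurable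
      (hφ.comp (measurable_const_add s)).aestronglyMeasurable]
  have hsplit : ∀ k ω, φ (T k ω + Z k ω) =
      ∑ s ∈ S, {ω | T k ω = s}.indicator (fun ω => φ (s + Z k ω)) ω := fun k ω => by
    rw [Finset.sum_eq_single_of_mem (T k ω) (hTS k ω)]
    · simp
    · intro s _ hs; simp [hs.symm]
  have hintT : ∀ k, Integrable (fun ω => φ (T k ω + Z k ω)) P := fun k => by
    simp_rw [hsplit k]
    exact integrable_finsetSum _ fun s hs => (hintZ k s hs).indicator (hm k _ (hTs k k s))
  have hE : ∀ k, ∫ ω in belowEvent φ T Z a k, φ (T k ω + Z k ω) ∂P =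
      ∑ s ∈ S, P.real (belowEvent φ T Z a k ∩ {ω | T k ω = s}) * ∫ z, φ (s + z) ∂ν := fun k => by
    simp_rw [hsplit k]
    rw [integral_finsetSum]
    · refine Finset.sum_congr rfl fun s hs => ?_
      rw [setIntegral_indicator (hm k _ (hTs k k s)), hindep k _ ((hA k).inter (hTs k k s))]
    · exact fun s hs => ((hintZ k s hs).indicator (hm k _ (hTs k k s))).integrableOn
  have hlow : ∀ k, d * P.real (belowEvent φ T Z a k) - |d + θ| * P.real {ω | T k ω ≠ s₀} ≤
      ∫ ω in belowEvent φ T Z a k, φ (T k ω + Z k ω) ∂P := fun k => by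
    have hPsum : P.real (belowEvent φ T Z a k) =
        ∑ s ∈ S, P.real (belowEvent φ T Z a k ∩ {ω | T k ω = s}) := by
      rw [← measureReal_biUnion_finset]
      · congr 1; ext ω; simp [hTS k ω]
      · intro s _ t _ hst
        refine Set.disjoint_left.2 fun ω h1 h2 => hst (h1.2.symm.trans h2.2)
      · exact fun s _ => (hA' k).inter (hm k _ (hTs k k s))
    have hQsum : ∑ s ∈ S, (if s = s₀ then 0 else
        P.real (belowEvent φ T Z a k ∩ {ω | T k ω = s})) ≤ P.real {ω | T k ω ≠ s₀} := by
      have : ∑ s ∈ S, (if s = s₀ then 0 else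
          P.real (belowEvent φ T Z a k ∩ {ω | T k ω = s})) =
          ∑ s ∈ S.erase s₀, P.real (belowEvent φ T Z a k ∩ {ω | T k ω = s}) := by
        rw [← Finset.filter_ne', Finset.sum_filter]
        exact Finset.sum_congr rfl fun s _ => by by_cases h : s = s₀ <;> simp [h]
      rw [this, ← measureReal_biUnion_finset]
      · refine measureReal_mono ?_
        intro ω hω
        simp only [Set.mem_iUnion, Finset.mem_erase] at hω
        obtain ⟨s, hs, h1, h2⟩ := hω
        have h2' : T k ω = s := h2
        simpa [h2'] using hs.1
      · intro s _ t _ hst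
        refine Set.disjoint_left.2 fun ω h1 h2 => hst (h1.2.symm.trans h2.2)
      · exact fun s _ => (hA' k).inter (hm k _ (hTs k k s))
    rw [hE, hPsum, Finset.mul_sum]
    have h3 := mul_le_mul_of_nonneg_left hQsum (abs_nonneg (d + θ))
    rw [Finset.mul_sum] at h3
    refine (sub_le_sub_left h3 _).trans ?_
    rw [← Finset.sum_sub_distrib]
    refine Finset.sum_le_sum fun s hs => ?_
    have hp := measureReal_nonneg (μ := P) (s := belowEvent φ T Z a k ∩ {ω | T k ω = s})
    -- For `s ≠ s₀` the mean is at least `-θ`, and `-θ ≥ d - |d + θ|`.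
    by_cases h : s = s₀
    · subst h; simp only [if_true]; nlinarith
    · simp only [h, if_false]
      nlinarith [hθ s hs, le_abs_self (d + θ), mul_le_mul_of_nonneg_left (hθ s hs) hp,
        mul_le_mul_of_nonneg_left (le_abs_self (d + θ)) hp]
  have hpath : ∑ k ∈ Finset.range n, ∫ ω in belowEvent φ T Z a k, φ (T k ω + Z k ω) ∂P ≤
      a + K := by
    have : ∑ k ∈ Finset.range n, ∫ ω in belowEvent φ T Z a k, φ (T k ω + Z k ω) ∂P =
        ∫ ω, ∑ k ∈ Finset.range n,
          (if ω ∈ belowEvent φ T Z a k then φ (T k ω + Z k ω) else 0) ∂P := by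
      rw [integral_finsetSum]
      · exact Finset.sum_congr rfl fun k _ => (integral_indicator (hA' k)).symm
      · exact fun k _ => (hintT k).indicator (hA' k)
    rw [this]
    calc _ ≤ ∫ _, (a + K) ∂P := by
          refine integral_mono (integrable_finsetSum _ fun k _ => (hintT k).indicator (hA' k))
            (integrable_const _) fun ω => ?_
          exact sum_stopped_le ha hK (fun k => hφK _) (fun k => ω ∈ belowEvent φ T Z a k)
            (fun k => Iff.rfl) n
      _ = a + K := by simp
  have := Finset.sum_le_sum fun k (_ : k ∈ Finset.range n) => hlow k
  rw [Finset.sum_sub_distrib, ← Finset.mul_sum, ← Finset.mul_sum] at this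
  linarith

/-- Truncating finitely many integrable functions from above changes their means by at most `ε`
if the truncation level is high enough. -/
theorem exists_truncation {ν : Measure ℝ} (S : Finset ℝ) {φ : ℝ → ℝ} (hφ : Measurable φ)
    (hint : ∀ s ∈ S, Integrable (fun z => φ (s + z)) ν) {ε : ℝ} (hε : 0 < ε) :
    ∃ K : ℝ, 0 ≤ K ∧ ∀ s ∈ S, Integrable (fun z => min (φ (s + z)) K) ν ∧
      ∫ z, φ (s + z) ∂ν - ε ≤ ∫ z, min (φ (s + z)) K ∂ν := by
  have hI : ∀ s ∈ S, ∀ K : ℝ, 0 ≤ K → ∀ z, ‖min (φ (s + z)) K‖ ≤ |φ (s + z)| := by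
    intro s _ K hK z
    rcases le_total (φ (s + z)) K with h | h
    · simp [h]
    · rw [min_eq_right h, Real.norm_eq_abs, abs_of_nonneg hK]
      exact h.trans (le_abs_self _)
  have hmeas : ∀ s, ∀ K : ℝ, AEStronglyMeasurable (fun z => min (φ (s + z)) K) ν := fun s K =>
    ((hφ.comp (measurable_const_add s)).min measurable_const).aestronglyMeasurable
  have hlim : ∀ s ∈ S, Tendsto (fun n : ℕ => ∫ z, min (φ (s + z)) n ∂ν) atTop
      (𝓝 (∫ z, φ (s + z) ∂ν)) := fun s hs => by
    refine tendsto_integral_of_dominated_convergence (fun z => |φ (s + z)|)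
      (fun n => hmeas s n) (hint s hs).abs
      (fun n => ae_of_all _ (hI s hs n n.cast_nonneg)) (ae_of_all _ fun z => ?_)
    obtain ⟨N, hN⟩ := exists_nat_ge (φ (s + z))
    refine tendsto_const_nhds.congr' ?_
    filter_upwards [eventually_ge_atTop N] with n hn
    exact (min_eq_left (hN.trans (by exact_mod_cast hn))).symm
  have hev : ∀ᶠ n : ℕ in atTop, ∀ s ∈ S, ∫ z, φ (s + z) ∂ν - ε ≤ ∫ z, min (φ (s + z)) n ∂ν :=
    (Filter.eventually_all_finset S).2 fun s hs =>
      (hlim s hs).eventually (Ici_mem_nhds (by linarith))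
  obtain ⟨n, hn⟩ := hev.exists
  exact ⟨n, n.cast_nonneg, fun s hs => ⟨(hint s hs).abs.mono' (hmeas s n)
    (ae_of_all _ (hI s hs n n.cast_nonneg)), hn s hs⟩⟩

/-! ### Chernoff bound with a one-sided exponential moment -/

/-- The lower tails of the sums of i.i.d. random variables `Y k` with integrable `Y k` and
`exp (-Y k)` are summable. -/
theorem summable_measureReal_sum_le {Ω : Type*} [MeasurableSpace Ω] {P : Measure Ω}
    [IsProbabilityMeasure P] {Y : ℕ → Ω → ℝ} (hY : ∀ k, Measurable (Y k)) (hind : iIndepFun Y P)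
    (hid : ∀ k, IdentDistrib (Y k) (Y 0) P P) (hint : Integrable (Y 0) P)
    (hexp : Integrable (fun ω => Real.exp (-Y 0 ω)) P) {x : ℝ} (hx : x < ∫ ω, Y 0 ω ∂P) :
    Summable fun n : ℕ => P.real {ω | ∑ k ∈ Finset.range n, Y k ω ≤ n * x} := by
  -- the slopes `(exp (-θ (Y - x)) - 1) / θ` at `θ = 1 / (n + 1)`
  let θ : ℕ → ℝ := fun n => 1 / ((n : ℝ) + 1)
  have hθ0 : ∀ n, 0 < θ n := fun n => by positivity
  have hθ1 : ∀ n, θ n ≤ 1 := fun n => by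
    simp only [θ]; rw [div_le_one (by positivity)]; linarith [n.cast_nonneg (α := ℝ)]
  -- Convexity of exp traps the slope between `-y` and `exp (-y) - 1`: a domination uniform in `t`.
  have hle : ∀ (t y : ℝ), 0 < t → t ≤ 1 → |(Real.exp (-(t * y)) - 1) / t| ≤
      |y| + (Real.exp (-y) + 1) := by
    intro t y ht ht1
    have h1 : -y ≤ (Real.exp (-(t * y)) - 1) / t := by
      rw [le_div_iff₀ ht]; linarith [Real.add_one_le_exp (-(t * y))]
    have h2 : (Real.exp (-(t * y)) - 1) / t ≤ Real.exp (-y) - 1 := by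
      rw [div_le_iff₀ ht]
      have := convexOn_exp.2 (Set.mem_univ (-y)) (Set.mem_univ 0) ht.le
        (sub_nonneg.2 ht1) (by ring)
      simp only [smul_eq_mul, mul_zero, add_zero, Real.exp_zero, mul_one, mul_neg] at this
      linarith
    rw [abs_le]
    constructor
    · linarith [neg_abs_le (-y), abs_neg y, Real.exp_pos (-y), neg_abs_le y, le_abs_self y]
    · linarith [abs_nonneg y]
  have hexpθ : ∀ t : ℝ, 0 ≤ t → t ≤ 1 → Integrable (fun ω => Real.exp (-t * Y 0 ω)) P := by
    intro t ht ht1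
    refine (hexp.add (integrable_const (1 : ℝ))).mono' (by fun_prop) (ae_of_all _ fun ω => ?_)
    rw [Real.norm_eq_abs, abs_of_pos (Real.exp_pos _)]
    rcases le_total 0 (Y 0 ω) with h | h
    · have : Real.exp (-t * Y 0 ω) ≤ 1 := Real.exp_le_one_iff.2 (by nlinarith)
      simp only [Pi.add_apply]; linarith [Real.exp_pos (-Y 0 ω)]
    · have : Real.exp (-t * Y 0 ω) ≤ Real.exp (-Y 0 ω) := Real.exp_le_exp.2 (by nlinarith)
      simp only [Pi.add_apply]; linarith
  have hexpx : Integrable (fun ω => Real.exp (-(Y 0 ω - x))) P := by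
    have : (fun ω => Real.exp (-(Y 0 ω - x))) = fun ω => Real.exp x * Real.exp (-Y 0 ω) := by
      ext ω; rw [← Real.exp_add]; ring_nf
    rw [this]; exact hexp.const_mul _
  have hlim : Tendsto (fun n => ∫ ω, (Real.exp (-(θ n * (Y 0 ω - x))) - 1) / θ n ∂P) atTop
      (𝓝 (∫ ω, -(Y 0 ω - x) ∂P)) := by
    refine tendsto_integral_of_dominated_convergence
      (fun ω => |Y 0 ω - x| + (Real.exp (-(Y 0 ω - x)) + 1))
      (fun n => by fun_prop)
      ((hint.sub (integrable_const x)).abs.add (hexpx.add (integrable_const 1)))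
      (fun n => ae_of_all _ fun ω => hle _ _ (hθ0 n) (hθ1 n)) (ae_of_all _ fun ω => ?_)
    have hd : HasDerivAt (fun t : ℝ => Real.exp (-(t * (Y 0 ω - x)))) (-(Y 0 ω - x)) 0 := by
      have := ((hasDerivAt_id (0 : ℝ)).mul_const (Y 0 ω - x)).neg.exp
      simpa using this
    have hs := hd.tendsto_slope_zero_right
    have hθlim : Tendsto θ atTop (𝓝[>] 0) :=
      tendsto_nhdsWithin_iff.2 ⟨tendsto_one_div_add_atTop_nhds_zero_nat,
        Eventually.of_forall hθ0⟩
    refine (hs.comp hθlim).congr fun n => ?_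
    simp [div_eq_inv_mul]
  have hneg : ∫ ω, -(Y 0 ω - x) ∂P < 0 := by
    rw [integral_neg, integral_sub hint (integrable_const x)]; simpa using hx
  obtain ⟨N, hN⟩ := (hlim.eventually (gt_mem_nhds hneg)).exists
  set t := θ N with ht
  -- The left side is E exp(-t (Y - x)). Its right derivative at t = 0 is x - E Y < 0, so it drops
  -- below 1 for the small `t` just chosen; it is the ratio of the dominating geometric series.
  have hr : Real.exp (t * x) * mgf (Y 0) P (-t) < 1 := by
    have h1 : Real.exp (t * x) * mgf (Y 0) P (-t) =
        ∫ ω, Real.exp (-(t * (Y 0 ω - x))) ∂P := by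
      rw [mgf, ← integral_const_mul]
      congr 1; ext ω; rw [← Real.exp_add]; ring_nf
    have h2 : Integrable (fun ω => Real.exp (-(t * (Y 0 ω - x)))) P := by
      have : (fun ω => Real.exp (-(t * (Y 0 ω - x)))) =
          fun ω => Real.exp (t * x) * Real.exp (-t * Y 0 ω) := by
        ext ω; rw [← Real.exp_add]; ring_nf
      rw [this]; exact (hexpθ t (hθ0 N).le (hθ1 N)).const_mul _
    rw [integral_div, integral_sub h2 (integrable_const 1)] at hN
    have h3 := (div_lt_iff₀ (hθ0 N)).1 hN
    rw [h1]; simp at h3; linarith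
  refine Summable.of_nonneg_of_le (fun n => measureReal_nonneg) (fun n => ?_)
    (summable_geometric_of_lt_one
      (mul_nonneg (Real.exp_pos _).le mgf_nonneg) hr)
  have hsumint : Integrable (fun ω => Real.exp (-t * (∑ k ∈ Finset.range n, Y k) ω)) P :=
    hind.integrable_exp_mul_sum hY fun k _ =>
      ((hid k).comp (u := fun y => Real.exp (-t * y)) (by fun_prop)).integrable_iff.2
        (hexpθ t (hθ0 N).le (hθ1 N))
  have hch := measure_le_le_exp_mul_mgf (μ := P) (X := ∑ k ∈ Finset.range n, Y k) (n * x)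
    (neg_nonpos.2 (hθ0 N).le) hsumint
  simp only [Finset.sum_apply] at hch
  refine hch.trans (le_of_eq ?_)
  rw [hind.mgf_sum hY, Finset.prod_congr rfl fun k _ =>
    mgf_congr_of_identDistrib (Y k) (Y 0) (hid k) (-t), Finset.prod_const, Finset.card_range,
    mul_pow, ← Real.exp_nat_mul]
  congr 2
  rw [ht]
  ring

/-! ### Pathwise passage time of a modulated walk -/

/-- Averages up to `⌊x a⌋`, normalized by `a`. -/
theorem tendsto_sum_floor_div {u : ℕ → ℝ} {m : ℝ}
    (hu : Tendsto (fun n : ℕ => (∑ k ∈ Finset.range n, u k) / n) atTop (𝓝 m)) {x : ℝ}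
    (hx : 0 < x) :
    Tendsto (fun a : ℝ => (∑ k ∈ Finset.range ⌊x * a⌋₊, u k) / a) atTop (𝓝 (m * x)) := by
  have hfl : Tendsto (fun a : ℝ => ⌊x * a⌋₊) atTop atTop :=
    tendsto_nat_floor_atTop.comp (tendsto_id.const_mul_atTop hx)
  refine ((hu.comp hfl).mul (tendsto_nat_floor_mul_div_atTop hx.le)).congr' ?_
  filter_upwards [hfl.eventually (eventually_gt_atTop 0)] with a ha
  have : (⌊x * a⌋₊ : ℝ) ≠ 0 := by exact_mod_cast ha.ne'
  simp only [Function.comp]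
  field_simp

/-- A walk whose modulation is `0` up to about time `a / D` and `s₀` afterwards reaches the level
`a` before time `β a`. -/
theorem eventually_le_sum_floor {φ : ℝ → ℝ} {S : Finset ℝ} {s₀ : ℝ} (h0S : (0 : ℝ) ∈ S)
    (hsS : s₀ ∈ S) {z : ℕ → ℝ} {T : ℝ → ℕ → ℝ} (hTS : ∀ a > 0, ∀ k, T a k ∈ S)
    {m₀ m₁ M₀ D θ β : ℝ} (hD : 0 < D) (hm₁ : 0 < m₁) (hm₀ : -θ ≤ m₀) (hθ : 0 ≤ θ)
    (h0 : Tendsto (fun n : ℕ => (∑ k ∈ Finset.range n, φ (0 + z k)) / n) atTop (𝓝 m₀))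
    (h1 : Tendsto (fun n : ℕ => (∑ k ∈ Finset.range n, φ (s₀ + z k)) / n) atTop (𝓝 m₁))
    (hΨ : Tendsto (fun n : ℕ => (∑ k ∈ Finset.range n, ∑ s ∈ S, |φ (s + z k)|) / n) atTop
      (𝓝 M₀))
    (hT : ∀ η : ℝ, 0 < η → η < 1 → ∃ M : ℕ, ∀ a > 0, ∀ k ≥ M,
      ((k + 1 : ℝ) ≤ (1 - η) / D * a → T a k = 0) ∧
      ((1 + η) / D * a ≤ (k + 1 : ℝ) → T a k = s₀))
    (hβ : 1 / D + (1 + θ / D) / m₁ < β) :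
    ∀ᶠ a : ℝ in atTop, a ≤ ∑ k ∈ Finset.range ⌊β * a⌋₊, φ (T a k + z k) := by
  set Ψ : ℕ → ℝ := fun k => ∑ s ∈ S, |φ (s + z k)| with hΨdef
  have hle : ∀ s ∈ S, ∀ k, |φ (s + z k)| ≤ Ψ k := fun s hs k =>
    Finset.single_le_sum (f := fun s => |φ (s + z k)|) (fun _ _ => abs_nonneg _) hs
  have hβ1 : 1 + θ / D < (β - 1 / D) * m₁ := by
    rw [← div_lt_iff₀ hm₁]; linarith
  -- a margin `η` around the time `a / D`
  obtain ⟨η, hη0, hη1, hηβ, hη⟩ : ∃ η : ℝ, 0 < η ∧ η < 1 ∧ (1 + η) / D < β ∧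
      1 < m₀ * ((1 - η) / D) + (m₁ * β - m₁ * ((1 + η) / D)) -
        (M₀ * ((1 + η) / D) - M₀ * ((1 - η) / D)) := by
    have hc : ContinuousAt (fun η : ℝ => m₀ * ((1 - η) / D) + (m₁ * β - m₁ * ((1 + η) / D)) -
        (M₀ * ((1 + η) / D) - M₀ * ((1 - η) / D))) 0 := by fun_prop
    have hc2 : ContinuousAt (fun η : ℝ => (1 + η) / D) 0 := by fun_prop
    -- At η = 0 the window terms cancel, leaving m₀ / D + m₁ (β - 1 / D), which exceeds 1 by `hβ1`
    -- and m₀ ≥ -θ.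
    have e1 := hc.eventually (lt_mem_nhds (a := 1) (by
      have h3 : -θ * (1 / D) ≤ m₀ * (1 / D) :=
        mul_le_mul_of_nonneg_right hm₀ (by positivity)
      have h4 : -θ * (1 / D) = -(θ / D) := by ring
      simp only [sub_zero, add_zero, sub_self]
      nlinarith))
    have e2 := hc2.eventually (gt_mem_nhds (a := β) (by
      have : 0 < (1 + θ / D) / m₁ := by positivity
      simp only [add_zero]; linarith))
    have e : ∀ᶠ η : ℝ in 𝓝[>] 0, 0 < η ∧ η < 1 ∧ (1 + η) / D < β ∧
        1 < m₀ * ((1 - η) / D) + (m₁ * β - m₁ * ((1 + η) / D)) -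
          (M₀ * ((1 + η) / D) - M₀ * ((1 - η) / D)) := by
      filter_upwards [self_mem_nhdsWithin, nhdsWithin_le_nhds e1, nhdsWithin_le_nhds e2,
        nhdsWithin_le_nhds (gt_mem_nhds one_pos)] with η a b c d
      exact ⟨a, d, c, b⟩
    exact e.exists
  obtain ⟨M, hM⟩ := hT η hη0 hη1
  have hp : 0 < (1 - η) / D := div_pos (by linarith) hD
  have hq : 0 < (1 + η) / D := by positivity
  have hβ0 : 0 < β := hq.trans hηβ
  -- A lower bound for the walk divided by `a`: input 0 before the window, `s₀` after it, the loss
  -- `Ψ` inside. On the first `M` steps the input is uncontrolled; replacing the presumed increment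
  -- by the true one costs at most `2 * Ψ`.
  have hlim : Tendsto (fun a : ℝ => (∑ k ∈ Finset.range ⌊(1 - η) / D * a⌋₊, φ (0 + z k)) / a +
      ((∑ k ∈ Finset.range ⌊β * a⌋₊, φ (s₀ + z k)) / a -
        (∑ k ∈ Finset.range ⌊(1 + η) / D * a⌋₊, φ (s₀ + z k)) / a) -
      ((∑ k ∈ Finset.range ⌊(1 + η) / D * a⌋₊, Ψ k) / a -
        (∑ k ∈ Finset.range ⌊(1 - η) / D * a⌋₊, Ψ k) / a) -
      (∑ k ∈ Finset.range M, 2 * Ψ k) / a) atTop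
      (𝓝 (m₀ * ((1 - η) / D) + (m₁ * β - m₁ * ((1 + η) / D)) -
        (M₀ * ((1 + η) / D) - M₀ * ((1 - η) / D)) - 0)) :=
    (((tendsto_sum_floor_div h0 hp).add ((tendsto_sum_floor_div h1 hβ0).sub
      (tendsto_sum_floor_div h1 hq))).sub ((tendsto_sum_floor_div hΨ hq).sub
      (tendsto_sum_floor_div hΨ hp))).sub (tendsto_const_nhds.div_atTop tendsto_id)
  rw [sub_zero] at hlim
  have hMev : ∀ᶠ a : ℝ in atTop, M ≤ ⌊β * a⌋₊ :=
    (tendsto_nat_floor_atTop.comp (tendsto_id.const_mul_atTop hβ0)).eventually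
      (eventually_ge_atTop M)
  filter_upwards [hlim.eventually (lt_mem_nhds hη), eventually_gt_atTop 0, hMev] with a ha ha0 haM
  set p := ⌊(1 - η) / D * a⌋₊ with hpdef
  set q := ⌊(1 + η) / D * a⌋₊ with hqdef
  set n := ⌊β * a⌋₊ with hndef
  have hpq : p ≤ q := Nat.floor_mono (by gcongr; linarith)
  have hqn : q ≤ n := Nat.floor_mono (by gcongr)
  -- Every sum is rewritten over `range n`, which reduces the claim to a termwise comparison.
  have hind : ∀ (r : ℕ) (u : ℕ → ℝ), r ≤ n →
      ∑ k ∈ Finset.range r, u k = ∑ k ∈ Finset.range n, if k < r then u k else 0 := by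
    intro r u hr
    rw [← Finset.sum_filter]
    congr 1; ext k; simp; omega
  rw [← sub_div, ← sub_div, ← add_div, ← sub_div, ← sub_div, lt_div_iff₀ ha0, one_mul] at ha
  refine ha.le.trans ?_
  rw [hind p _ (hpq.trans hqn), hind q _ hqn, hind q _ hqn, hind p _ (hpq.trans hqn),
    hind M _ haM, ← Finset.sum_sub_distrib, ← Finset.sum_sub_distrib, ← Finset.sum_add_distrib,
    ← Finset.sum_sub_distrib, ← Finset.sum_sub_distrib]
  refine Finset.sum_le_sum fun k _ => ?_
  have b0 := abs_le.1 (hle 0 h0S k)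
  have b1 := abs_le.1 (hle s₀ hsS k)
  have bT := abs_le.1 (hle _ (hTS a ha0 k) k)
  have hkp : k < p → (k + 1 : ℝ) ≤ (1 - η) / D * a := fun h => by
    have : ((k + 1 : ℕ) : ℝ) ≤ (1 - η) / D * a :=
      (Nat.le_floor_iff (by positivity)).1 h
    exact_mod_cast this
  have hkq : ¬ k < q → (1 + η) / D * a ≤ (k + 1 : ℝ) := fun h =>
    (Nat.lt_floor_add_one _).le.trans (by gcongr; exact not_lt.1 h)
  by_cases hkM : k < M
  · split_ifs <;> first | omega | linarith
  · have hr := hM a ha0 k (not_lt.1 hkM)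
    by_cases h1 : k < p
    · have h2 : k < q := h1.trans_le hpq
      rw [hr.1 (hkp h1)]
      simp [hkM, h1, h2]
    · by_cases h2 : k < q
      · simp only [hkM, h1, h2, if_true, if_false]; linarith
      · rw [hr.2 (hkq h2)]
        simp [hkM, h1, h2]

/-! ### The local statistic under H_i -/

/-- The sign of the drift under `H_i`. -/
noncomputable def hypSign (i : Fin 2) : ℝ := if i = 0 then -1 else 1

theorem abs_hypSign (i : Fin 2) : |hypSign i| = 1 := by
  unfold hypSign; split_ifs <;> simp

namespace LocalNode

variable {𝒳 A : Type*} [MeasurableSpace 𝒳] [MeasurableSpace A]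

/-- The drift, up to its sign, of the local statistic under `H_i`. -/
noncomputable def nodeDrift (N : LocalNode 𝒳 A) (lam : ℝ) (i : Fin 2) : ℝ :=
  if i = 0 then lam / 2 else N.divergence.toReal - lam / 2

theorem isProbabilityMeasure_law (N : LocalNode 𝒳 A) (i : Fin 2) :
    IsProbabilityMeasure (N.law i) :=
  ⟨by rw [law, withDensity_apply _ MeasurableSet.univ, Measure.restrict_univ, N.f_lintegral i]⟩

/-- The log-likelihood ratio `log f_1 - log f_0` of one observation. -/
noncomputable def logRatio (N : LocalNode 𝒳 A) (x : 𝒳) : ℝ :=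
  Real.log (N.f 1 x) - Real.log (N.f 0 x)

theorem measurable_logRatio (N : LocalNode 𝒳 A) : Measurable N.logRatio :=
  (N.f_measurable 1).log.sub (N.f_measurable 0).log

theorem ae_pos (N : LocalNode 𝒳 A) (i : Fin 2) : ∀ᵐ x ∂N.law i, 0 < N.f i x := by
  rw [law, ae_withDensity_iff (N.f_measurable i).ennreal_ofReal]
  refine ae_of_all _ fun x hx => ?_
  simpa using hx

/-- Finite divergence gives `N.law 1 ≪ N.law 0`; the derivative is then the quotient of the two
densities with respect to `ref`, and both are positive almost everywhere under `N.law 1`. -/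
theorem logRatio_ae_eq (N : LocalNode 𝒳 A) (h : N.divergence ≠ ∞) :
    N.logRatio =ᵐ[N.law 1] llr (N.law 1) (N.law 0) := by
  have := N.ref_sigmaFinite
  have := N.isProbabilityMeasure_law 0
  have := N.isProbabilityMeasure_law 1
  have hac : N.law 1 ≪ N.law 0 := (InformationTheory.klDiv_ne_top_iff.1 h).1
  have h0 := withDensity_absolutelyContinuous N.ref (fun x => ENNReal.ofReal (N.f 0 x))
  have h1 := withDensity_absolutelyContinuous N.ref (fun x => ENNReal.ofReal (N.f 1 x))
  have e := hac (Measure.rnDeriv_eq_div (μ := N.law 1) (ν := N.law 0) (ξ := N.ref) h1 h0)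
  have e0 := h1 (N.ref.rnDeriv_withDensity (N.f_measurable 0).ennreal_ofReal)
  have e1 := h1 (N.ref.rnDeriv_withDensity (N.f_measurable 1).ennreal_ofReal)
  filter_upwards [e, e0, e1, N.ae_pos 1, hac (N.ae_pos 0)] with x hx hx0 hx1 p1 p0
  rw [llr, hx]
  unfold law
  rw [hx0, hx1, ENNReal.toReal_div, ENNReal.toReal_ofReal p1.le, ENNReal.toReal_ofReal p0.le,
    Real.log_div p1.ne' p0.ne', logRatio]

theorem integrable_logRatio (N : LocalNode 𝒳 A) (h : N.divergence ≠ ∞) :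
    Integrable N.logRatio (N.law 1) :=
  (InformationTheory.klDiv_ne_top_iff.1 h).2.congr (N.logRatio_ae_eq h).symm

theorem integral_logRatio (N : LocalNode 𝒳 A) (h : N.divergence ≠ ∞) :
    ∫ x, N.logRatio x ∂N.law 1 = N.divergence.toReal := by
  have := N.isProbabilityMeasure_law 0
  have := N.isProbabilityMeasure_law 1
  rw [integral_congr_ae (N.logRatio_ae_eq h), divergence,
    InformationTheory.toReal_klDiv_of_measure_eq (InformationTheory.klDiv_ne_top_iff.1 h).1
      (by simp)]

/-- The exponential is almost everywhere the derivative of `N.law 0` with respect to `N.law 1`. This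
is the exponential moment for the Chernoff bound. -/
theorem integrable_exp_neg_logRatio (N : LocalNode 𝒳 A) (h : N.divergence ≠ ∞) :
    Integrable (fun x => Real.exp (-N.logRatio x)) (N.law 1) := by
  have := N.isProbabilityMeasure_law 0
  have := N.isProbabilityMeasure_law 1
  have h1 : Integrable (fun x => ((N.law 0).rnDeriv (N.law 1) x).toReal) (N.law 1) :=
    Measure.integrable_toReal_rnDeriv
  refine h1.congr ?_
  filter_upwards [exp_neg_llr (InformationTheory.klDiv_ne_top_iff.1 h).1,
    N.logRatio_ae_eq h] with x hx hx'
  rw [hx', hx]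

/-- Exact at every point, even where a density vanishes, because `logRatio` is a difference of
logarithms. -/
theorem codingError_zero_eq (N : LocalNode 𝒳 A) (n : ℕ) (x : ℕ → 𝒳) :
    N.codingError 0 n x = N.codingError 1 n x + ∑ k ∈ Finset.range n, N.logRatio (x k) := by
  simp only [codingError, logRatio, Finset.sum_sub_distrib]; ring

theorem measurable_codingError [Countable A] [DiscreteMeasurableSpace A] (N : LocalNode 𝒳 A)
    (i : Fin 2) (n : ℕ) : Measurable (N.codingError i n) := by
  have h1 : Measurable (N.code.codeLength n) := measurable_of_countable _
  have h2 : Measurable fun x : ℕ → 𝒳 => fun k : Fin n => N.quantize (x k) :=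
    measurable_pi_lambda _ fun k => N.quantize_measurable.comp (measurable_pi_apply _)
  have h3 : Measurable fun x : ℕ → 𝒳 => ∑ k ∈ Finset.range n, Real.log (N.f i (x k)) :=
    Finset.measurable_fun_sum _ fun k _ => ((N.f_measurable i).comp (measurable_pi_apply k)).log
  exact (((h1.comp h2).neg.sub measurable_const).sub h3)

theorem measurable_statistic [Countable A] [DiscreteMeasurableSpace A] (N : LocalNode 𝒳 A)
    (lam : ℝ) (n : ℕ) : Measurable (N.statistic lam n) :=
  (N.measurable_codingError 0 n).sub measurable_const

/-- Under `H_i`, the statistic is its drift plus the coding error and, for `i = 1`, the fluctuation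
of the log-likelihood ratio. -/
theorem hypSign_mul_statistic (N : LocalNode 𝒳 A) (lam : ℝ) (i : Fin 2) (n : ℕ) (x : ℕ → 𝒳) :
    hypSign i * N.statistic lam n x = hypSign i * N.codingError i n x + n * N.nodeDrift lam i +
      if i = 0 then 0
      else (∑ k ∈ Finset.range n, N.logRatio (x k)) - n * N.divergence.toReal := by
  fin_cases i
  · simp [hypSign, nodeDrift, statistic]; ring
  · simp [hypSign, nodeDrift, statistic, codingError_zero_eq]; ring

theorem le_lastDeviation (N : LocalNode 𝒳 A) {i : Fin 2} {ε : ℝ} {x : ℕ → 𝒳} {n : ℕ}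
    (hn : 1 ≤ n) (h : n * ε < |N.codingError i n x|) : (n : ℕ∞) ≤ N.lastDeviation i ε x :=
  le_iSup₂_of_le (f := fun (n : ℕ) (_ : 1 ≤ n ∧ n * ε < |N.codingError i n x|) => (n : ℕ∞))
    n ⟨hn, h⟩ le_rfl

theorem identDistrib_logRatio {Ω : Type*} [MeasurableSpace Ω] {P : Measure Ω}
    {X : ℕ → Ω → 𝒳} (N : LocalNode 𝒳 A) (hX : ∀ k, Measurable (X k)) {i : Fin 2}
    (hlaw : ∀ k, P.map (X k) = N.law i) (k : ℕ) :
    IdentDistrib (fun ω => N.logRatio (X k ω)) (fun ω => N.logRatio (X 0 ω)) P P :=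
  IdentDistrib.comp ⟨(hX k).aemeasurable, (hX 0).aemeasurable, by rw [hlaw, hlaw]⟩
    N.measurable_logRatio

section Probability

variable {Ω : Type*} [MeasurableSpace Ω] {P : Measure Ω} [IsProbabilityMeasure P]
  {X : ℕ → Ω → 𝒳}

/-- If the expected last deviation time is finite, so is the expected number of deviations. -/
theorem summable_measureReal_codingError [Countable A] [DiscreteMeasurableSpace A]
    (N : LocalNode 𝒳 A) (i : Fin 2) (hX : ∀ k, Measurable (X k)) {ε : ℝ}
    (h : ∫⁻ ω, ((N.lastDeviation i ε (fun k => X k ω) : ℕ∞) : ℝ≥0∞) ∂P < ∞) :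
    Summable fun n : ℕ =>
      P.real {ω | ((n + 1 : ℕ) : ℝ) * ε < |N.codingError i (n + 1) (fun k => X k ω)|} := by
  classical
  let B : ℕ → Set Ω := fun n =>
    {ω | ((n + 1 : ℕ) : ℝ) * ε < |N.codingError i (n + 1) (fun k => X k ω)|}
  have hB : ∀ n, MeasurableSet (B n) := fun n => by
    have h1 : Measurable fun ω => N.codingError i (n + 1) (fun k => X k ω) :=
      (N.measurable_codingError i (n + 1)).comp (measurable_pi_lambda _ hX)
    exact measurableSet_lt measurable_const (by simpa using h1.norm)
  refine summable_of_sum_range_le (c := (∫⁻ ω,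
    ((N.lastDeviation i ε (fun k => X k ω) : ℕ∞) : ℝ≥0∞) ∂P).toReal)
    (fun n => measureReal_nonneg) fun n => ?_
  simp only [measureReal_def]
  rw [← ENNReal.toReal_sum fun _ _ => measure_ne_top _ _]
  refine ENNReal.toReal_mono h.ne ?_
  calc ∑ k ∈ Finset.range n, P (B k)
      = ∫⁻ ω, ∑ k ∈ Finset.range n, (B k).indicator 1 ω ∂P := by
        rw [lintegral_finsetSum _ fun k _ => measurable_one.indicator (hB k)]
        exact Finset.sum_congr rfl fun k _ => (lintegral_indicator_one (hB k)).symm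
    _ ≤ _ := by
        refine lintegral_mono fun ω => ?_
        have hsum : ∑ k ∈ Finset.range n, (B k).indicator (1 : Ω → ℝ≥0∞) ω =
            (((Finset.range n).filter fun k => ω ∈ B k).card : ℝ≥0∞) := by
          rw [Finset.card_filter]; push_cast
          exact Finset.sum_congr rfl fun k _ => by simp [Set.indicator_apply]
        rw [hsum]
        rcases eq_or_ne (N.lastDeviation i ε (fun k => X k ω)) ⊤ with hN | hN
        · simp [hN]
        · obtain ⟨m, hm⟩ := ENat.ne_top_iff_exists.1 hN
          rw [← hm, ENat.toENNReal_coe]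
          -- A deviation at time `k + 1` forces `k + 1 ≤ m`, so only the indices `k < m` can count.
          have : ((Finset.range n).filter fun k => ω ∈ B k).card ≤ m := by
            refine (Finset.card_le_card (t := Finset.range m) fun k hk => ?_).trans (by simp)
            have h1 := N.le_lastDeviation (n := k + 1) (by omega) (Finset.mem_filter.1 hk).2
            rw [← hm] at h1
            exact Finset.mem_range.2 (by exact_mod_cast h1)
          exact Nat.cast_le.2 this

/-- If the expected last deviation times are finite, the normalized coding error vanishes. -/
theorem ae_tendsto_codingError [Countable A] [DiscreteMeasurableSpace A] (N : LocalNode 𝒳 A)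
    (i : Fin 2) (hX : ∀ k, Measurable (X k)) (h : ∀ ε : ℝ, 0 < ε →
      ∫⁻ ω, ((N.lastDeviation i ε (fun k => X k ω) : ℕ∞) : ℝ≥0∞) ∂P < ∞) :
    ∀ᵐ ω ∂P, Tendsto (fun n : ℕ => N.codingError i n (fun k => X k ω) / n) atTop (𝓝 0) := by
  -- Borel–Cantelli along the countably many levels `1 / (j + 1)`.
  have h1 : ∀ᵐ ω ∂P, ∀ j : ℕ, ∀ᶠ n : ℕ in atTop,
      ¬ (((n + 1 : ℕ) : ℝ) * (1 / ((j : ℝ) + 1)) <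
        |N.codingError i (n + 1) (fun k => X k ω)|) := by
    rw [ae_all_iff]
    intro j
    have hs := N.summable_measureReal_codingError i hX (h (1 / ((j : ℝ) + 1)) (by positivity))
    refine ae_eventually_notMem (s := fun n : ℕ =>
      {ω | ((n + 1 : ℕ) : ℝ) * (1 / ((j : ℝ) + 1)) <
        |N.codingError i (n + 1) (fun k => X k ω)|}) ?_
    have := hs.tsum_ofReal_ne_top
    simpa only [ofReal_measureReal (measure_ne_top P _)] using this
  filter_upwards [h1] with ω hω
  rw [← tendsto_add_atTop_iff_nat 1, Metric.tendsto_atTop]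
  intro ε hε
  obtain ⟨j, hj⟩ := exists_nat_one_div_lt hε
  obtain ⟨m, hm⟩ := eventually_atTop.1 (hω j)
  refine ⟨m, fun n hn => ?_⟩
  have hn0 : (0 : ℝ) < ((n + 1 : ℕ) : ℝ) := by positivity
  rw [Real.dist_eq, sub_zero, abs_div, abs_of_pos hn0]
  refine lt_of_le_of_lt ?_ hj
  rw [div_le_iff₀ hn0]; linarith [not_lt.1 (hm n hn)]

/-- Under `H_i` the normalized statistic converges to its drift. -/
theorem ae_tendsto_statistic [Countable A] [DiscreteMeasurableSpace A] (N : LocalNode 𝒳 A)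
    (hX : ∀ k, Measurable (X k)) (hind : iIndepFun X P) {i : Fin 2} (hlaw : ∀ k, P.map (X k) = N.law i)
    (hfin : N.divergence ≠ ∞) (lam : ℝ) (h : ∀ ε : ℝ, 0 < ε →
      ∫⁻ ω, ((N.lastDeviation i ε (fun k => X k ω) : ℕ∞) : ℝ≥0∞) ∂P < ∞) :
    ∀ᵐ ω ∂P, Tendsto (fun n : ℕ => hypSign i * N.statistic lam n (fun k => X k ω) / n) atTop
      (𝓝 (N.nodeDrift lam i)) := by
  have hS : i ≠ 0 → ∀ᵐ ω ∂P, Tendsto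
      (fun n : ℕ => (∑ k ∈ Finset.range n, N.logRatio (X k ω)) / n) atTop
      (𝓝 N.divergence.toReal) := by
    intro hi
    obtain rfl : i = 1 := by omega
    have hint : Integrable (fun ω => N.logRatio (X 0 ω)) P := by
      have := N.integrable_logRatio hfin
      rw [← hlaw 0] at this
      exact this.comp_measurable (hX 0)
    have := strong_law_ae_real (fun k ω => N.logRatio (X k ω)) hint
      (fun j k hjk => (hind.comp (fun _ => N.logRatio)
        (fun _ => N.measurable_logRatio)).indepFun hjk)
      (N.identDistrib_logRatio hX hlaw)
    rwa [← integral_map (hX 0).aemeasurable N.measurable_logRatio.aestronglyMeasurable, hlaw,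
      N.integral_logRatio hfin] at this
  have hS' : ∀ᵐ ω ∂P, i ≠ 0 → Tendsto
      (fun n : ℕ => (∑ k ∈ Finset.range n, N.logRatio (X k ω)) / n) atTop
      (𝓝 N.divergence.toReal) := by
    by_cases hi : i = 0
    · simp [hi]
    · filter_upwards [hS hi] with ω hω _ using hω
  filter_upwards [N.ae_tendsto_codingError i hX h, hS'] with ω h1 h2
  have h3 : Tendsto (fun n : ℕ => if i = 0 then (0 : ℝ) else
      (∑ k ∈ Finset.range n, N.logRatio (X k ω)) / n - N.divergence.toReal) atTop (𝓝 0) := by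
    by_cases hi : i = 0
    · simp [hi]
    · simpa [hi] using (h2 hi).sub_const N.divergence.toReal
  have h4 := ((h1.const_mul (hypSign i)).add_const (N.nodeDrift lam i)).add h3
  rw [mul_zero, zero_add, add_zero] at h4
  refine h4.congr' ?_
  filter_upwards [eventually_gt_atTop 0] with n hn
  have hn0 : (n : ℝ) ≠ 0 := by exact_mod_cast hn.ne'
  rw [hypSign_mul_statistic]
  split_ifs <;> field_simp
  rw [mul_zero]

/-- Under `H_i` the expected number of times at which the statistic falls behind its drift is
finite. -/
theorem summable_measureReal_statistic [Countable A] [DiscreteMeasurableSpace A]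
    (N : LocalNode 𝒳 A) (hX : ∀ k, Measurable (X k)) (hind : iIndepFun X P) {i : Fin 2}
    (hlaw : ∀ k, P.map (X k) = N.law i) (hfin : N.divergence ≠ ∞) (lam : ℝ)
    (h : ∀ ε : ℝ, 0 < ε →
      ∫⁻ ω, ((N.lastDeviation i ε (fun k => X k ω) : ℕ∞) : ℝ≥0∞) ∂P < ∞)
    {x : ℝ} (hx : x < N.nodeDrift lam i) :
    Summable fun n : ℕ => P.real
      {ω | hypSign i * N.statistic lam (n + 1) (fun k => X k ω) < ((n + 1 : ℕ) : ℝ) * x} := by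
  -- Half of the gap is allotted to the coding error, half to the log-likelihood ratio; falling
  -- below `x` needs one of them to deviate.
  set ε := (N.nodeDrift lam i - x) / 2 with hε
  have hε0 : 0 < ε := by simp only [hε]; linarith
  have h1 := N.summable_measureReal_codingError i hX (h ε hε0)
  have h2 : Summable fun n : ℕ => if i = 0 then (0 : ℝ) else P.real
      {ω | ∑ k ∈ Finset.range (n + 1), N.logRatio (X k ω) ≤
        ((n + 1 : ℕ) : ℝ) * (N.divergence.toReal - ε)} := by
    by_cases hi : i = 0
    · simp [hi, summable_zero]
    · obtain rfl : i = 1 := by omega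
      simp only [one_ne_zero, if_false]
      have hint : Integrable (fun ω => N.logRatio (X 0 ω)) P := by
        have := N.integrable_logRatio hfin
        rw [← hlaw 0] at this
        exact this.comp_measurable (hX 0)
      have hexp : Integrable (fun ω => Real.exp (-N.logRatio (X 0 ω))) P := by
        have := N.integrable_exp_neg_logRatio hfin
        rw [← hlaw 0] at this
        exact this.comp_measurable (hX 0)
      have hmean : ∫ ω, N.logRatio (X 0 ω) ∂P = N.divergence.toReal := by
        rw [← integral_map (hX 0).aemeasurable N.measurable_logRatio.aestronglyMeasurable, hlaw,
          N.integral_logRatio hfin]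
      have hs := summable_measureReal_sum_le (x := N.divergence.toReal - ε)
        (Y := fun k ω => N.logRatio (X k ω)) (fun k => N.measurable_logRatio.comp (hX k))
        (hind.comp (fun _ => N.logRatio) (fun _ => N.measurable_logRatio))
        (N.identDistrib_logRatio hX hlaw) hint hexp (by rw [hmean]; linarith)
      exact hs.comp_injective (add_left_injective 1)
  refine Summable.of_nonneg_of_le (fun n => measureReal_nonneg) (fun n => ?_) (h1.add h2)
  have hsub : {ω | hypSign i * N.statistic lam (n + 1) (fun k => X k ω) <
      ((n + 1 : ℕ) : ℝ) * x} ⊆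
      {ω | ((n + 1 : ℕ) : ℝ) * ε < |N.codingError i (n + 1) (fun k => X k ω)|} ∪
      {ω | i ≠ 0 ∧ ∑ k ∈ Finset.range (n + 1), N.logRatio (X k ω) ≤
        ((n + 1 : ℕ) : ℝ) * (N.divergence.toReal - ε)} := by
    intro ω hω
    by_contra hcon
    simp only [Set.mem_union, Set.mem_ofPred_eq, not_or, not_lt, not_and, not_le] at hcon hω
    rw [hypSign_mul_statistic] at hω
    have h3 : -(((n + 1 : ℕ) : ℝ) * ε) ≤
        hypSign i * N.codingError i (n + 1) (fun k => X k ω) := by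
      have := neg_abs_le (hypSign i * N.codingError i (n + 1) (fun k => X k ω))
      rw [abs_mul, abs_hypSign, one_mul] at this
      linarith [hcon.1]
    have h4 : ((n + 1 : ℕ) : ℝ) * x = ((n + 1 : ℕ) : ℝ) * N.nodeDrift lam i -
        ((n + 1 : ℕ) : ℝ) * ε - ((n + 1 : ℕ) : ℝ) * ε := by
      rw [hε]; ring
    have h5 : 0 < ((n + 1 : ℕ) : ℝ) * ε := by positivity
    by_cases hi : i = 0
    · rw [if_pos hi] at hω; linarith
    · rw [if_neg hi] at hω; linarith [hcon.2 hi, mul_sub ((n + 1 : ℕ) : ℝ) N.divergence.toReal ε]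
  refine (measureReal_mono hsub).trans ((measureReal_union_le _ _).trans ?_)
  gcongr
  by_cases hi : i = 0 <;> simp [hi]

end Probability

end LocalNode

/-! ### Passage times as sums of indicators, and limsup tools -/

theorem measurableSet_belowEvent {Ω : Type*} [MeasurableSpace Ω] {φ : ℝ → ℝ} {T Z : ℕ → Ω → ℝ}
    (hφ : Measurable φ) (hT : ∀ k, Measurable (T k)) (hZ : ∀ k, Measurable (Z k)) (a : ℝ)
    (k : ℕ) : MeasurableSet (belowEvent φ T Z a k) := by
  have : belowEvent φ T Z a k =
      ⋂ j ∈ Finset.range (k + 1), {ω | ∑ i ∈ Finset.range j, φ (T i ω + Z i ω) < a} := by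
    ext ω; simp [belowEvent]
  rw [this]
  refine Finset.measurableSet_biInter _ fun j _ => measurableSet_lt ?_ measurable_const
  exact Finset.measurable_fun_sum _ fun i _ => hφ.comp ((hT i).add (hZ i))

/-- A passage time is at most the number of times up to which the walk stays below `a`. -/
theorem toENNReal_le_tsum_belowEvent {Ω : Type*} {φ : ℝ → ℝ} {T Z : ℕ → Ω → ℝ} {a : ℝ} {ω : Ω}
    {τ : ℕ∞} (hτ : ∀ j : ℕ, a ≤ ∑ i ∈ Finset.range j, φ (T i ω + Z i ω) → τ ≤ j) :
    (τ : ℝ≥0∞) ≤ ∑' k, (belowEvent φ T Z a k).indicator 1 ω := by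
  classical
  by_cases h : ∃ k, ω ∉ belowEvent φ T Z a k
  · have hk := Nat.find_spec h
    -- At the first failing index `k` the preceding `k` indicators equal 1, and the level was
    -- reached at some `j ≤ k`.
    set k := Nat.find h with hkdef
    obtain ⟨j, hjk, hj⟩ : ∃ j ≤ k, a ≤ ∑ i ∈ Finset.range j, φ (T i ω + Z i ω) := by
      simpa [belowEvent] using hk
    calc (τ : ℝ≥0∞) ≤ ((j : ℕ∞) : ℝ≥0∞) := ENat.toENNReal_le.2 (hτ j hj)
      _ = (j : ℝ≥0∞) := ENat.toENNReal_coe j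
      _ ≤ (k : ℝ≥0∞) := Nat.cast_le.2 hjk
      _ = ∑ i ∈ Finset.range k, (belowEvent φ T Z a i).indicator (1 : Ω → ℝ≥0∞) ω := by
          rw [Finset.sum_congr rfl fun i hi => Set.indicator_of_mem
            (not_not.1 (Nat.find_min h (Finset.mem_range.1 hi))) _]
          simp [← hkdef]
      _ ≤ _ := ENNReal.sum_le_tsum _
  · push Not at h
    have : ∑' k, (belowEvent φ T Z a k).indicator (1 : Ω → ℝ≥0∞) ω = ⊤ := by
      rw [tsum_congr fun k => Set.indicator_of_mem (h k) _]
      simp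
    rw [this]; exact le_top

/-- Leaves room for the small parameters: each `β` strictly above the bound may use its own η or ε,
and then `β` decreases to `B`. -/
theorem limsup_le_ofReal {f : ℝ → ℝ≥0∞} {l : Filter ℝ} {B : ℝ}
    (h : ∀ β > B, ∀ᶠ c in l, f c ≤ ENNReal.ofReal β) : limsup f l ≤ ENNReal.ofReal B := by
  have hlim : Tendsto (fun β : ℝ => ENNReal.ofReal β) (𝓝[>] B) (𝓝 (ENNReal.ofReal B)) :=
    (ENNReal.continuous_ofReal.tendsto B).mono_left nhdsWithin_le_nhds
  refine ge_of_tendsto hlim ?_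
  filter_upwards [self_mem_nhdsWithin] with β hβ
  exact limsup_le_of_le (by isBoundedDefault) (h β hβ)

theorem tendsto_abs_log_nhdsGT_zero : Tendsto (fun c : ℝ => |Real.log c|) (𝓝[>] 0) atTop :=
  tendsto_abs_atBot_atTop.comp Real.tendsto_log_nhdsGT_zero

theorem card_filter_lt_le (n : ℕ) {x : ℝ} (hx : 0 ≤ x) :
    (((Finset.range n).filter fun k : ℕ => ((k + 1 : ℕ) : ℝ) < x).card : ℝ) ≤ x := by
  refine le_trans ?_ (Nat.floor_le hx)
  have : ((Finset.range n).filter fun k : ℕ => ((k + 1 : ℕ) : ℝ) < x) ⊆ Finset.range ⌊x⌋₊ := by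
    intro k hk
    exact Finset.mem_range.2 ((Nat.le_floor_iff hx).2 (Finset.mem_filter.1 hk).2.le)
  exact_mod_cast (Finset.card_le_card this).trans (by simp)

/-! ### Increments at the fusion center -/

namespace FusionCenter

variable (fc : FusionCenter)

theorem measurable_llr : Measurable fc.llr :=
  (((fc.g_measurable.comp (measurable_id.sub_const _)).div
    (fc.g_measurable.comp (measurable_id.add_const _)))).log

/-- The increment of the fusion center statistic, with the sign that makes its drift positive. -/
noncomputable def signedLlr (i : Fin 2) (y : ℝ) : ℝ := hypSign i * fc.llr y

theorem measurable_signedLlr (i : Fin 2) : Measurable (fc.signedLlr i) :=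
  fc.measurable_llr.const_mul _

theorem integral_signedLlr (i : Fin 2) (s : ℝ) :
    ∫ z, fc.signedLlr i (s + z) ∂fc.noise = hypSign i * fc.meanIncrement s :=
  integral_const_mul _ _

/-- The values of the sum of the local transmissions. -/
noncomputable def sumValues (L : ℕ) : Finset ℝ :=
  (((Finset.range (L + 1)) ×ˢ (Finset.range (L + 1))).filter fun p => p.1 + p.2 ≤ L).image
    fun p => (p.1 : ℝ) * fc.b 1 + p.2 * fc.b 0

theorem mem_sumValues {L : ℕ} {s : ℝ} :
    s ∈ fc.sumValues L ↔ ∃ j k : ℕ, j + k ≤ L ∧ s = j * fc.b 1 + k * fc.b 0 := by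
  simp only [sumValues, Finset.mem_image, Finset.mem_filter, Finset.mem_product,
    Finset.mem_range, Prod.exists]
  constructor
  · rintro ⟨j, k, ⟨_, h⟩, rfl⟩; exact ⟨j, k, h, rfl⟩
  · rintro ⟨j, k, h, rfl⟩; exact ⟨j, k, ⟨⟨by omega, by omega⟩, h⟩, rfl⟩

theorem zero_mem_sumValues (L : ℕ) : (0 : ℝ) ∈ fc.sumValues L :=
  fc.mem_sumValues.2 ⟨0, 0, by simp, by simp⟩

theorem mul_b_mem_sumValues (L : ℕ) (i : Fin 2) : (L : ℝ) * fc.b i ∈ fc.sumValues L := by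
  fin_cases i
  · exact fc.mem_sumValues.2 ⟨0, L, by simp, by simp⟩
  · exact fc.mem_sumValues.2 ⟨L, 0, by simp, by simp⟩

theorem integrable_signedLlr {L : ℕ} (i : Fin 2)
    (hint : ∀ j k : ℕ, j + k ≤ L →
      Integrable (fun z => fc.llr (j * fc.b 1 + k * fc.b 0 + z)) fc.noise)
    {s : ℝ} (hs : s ∈ fc.sumValues L) :
    Integrable (fun z => fc.signedLlr i (s + z)) fc.noise := by
  obtain ⟨j, k, hjk, rfl⟩ := fc.mem_sumValues.1 hs
  exact (hint j k hjk).const_mul _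

/-- The signed worst mean is at least -|θ_i| ≥ -E_i|ξ^*|; this is how E_i|ξ^*| enters C_i. -/
theorem neg_integral_abs_wrongIncrement_le {L : ℕ} {i : Fin 2} (hworst : fc.WrongIsWorst L i)
    {s : ℝ} (hs : s ∈ fc.sumValues L) :
    -∫ z, |fc.wrongIncrement L i z| ∂fc.noise ≤ ∫ z, fc.signedLlr i (s + z) ∂fc.noise := by
  obtain ⟨j, k, hjk, rfl⟩ := fc.mem_sumValues.1 hs
  have h1 : |fc.wrongDrift L i| ≤ ∫ z, |fc.wrongIncrement L i z| ∂fc.noise :=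
    abs_integral_le_integral_abs
  have h2 := abs_le.1 h1
  rw [integral_signedLlr]
  obtain ⟨w0, w1⟩ := hworst j k hjk
  rcases (show i = 0 ∨ i = 1 by omega) with hi | hi
  · have := w0 hi
    rw [hypSign, if_pos hi]; linarith
  · have := w1 hi
    rw [hypSign, if_neg (by omega)]; linarith

end FusionCenter

/-! ### Local thresholds and transmissions -/

namespace DecentralizedTest

variable {L : ℕ} {𝒳 A : Fin L → Type*} [∀ l, MeasurableSpace (𝒳 l)] [∀ l, MeasurableSpace (A l)]
  (node : (l : Fin L) → LocalNode (𝒳 l) (A l)) (fc : FusionCenter)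

theorem Dtot_eq_sum (lam : ℝ) (i : Fin 2) : Dtot node lam i = ∑ l, (node l).nodeDrift lam i := by
  unfold Dtot LocalNode.nodeDrift
  split_ifs
  · simp; ring
  · rfl

variable {node} in
theorem nodeDrift_pos {lam : ℝ} (hlam : 0 < lam)
    (hclass : ∀ l, ENNReal.ofReal lam ≤ (node l).divergence)
    (hfinite : ∀ l, (node l).divergence ≠ ∞) (i : Fin 2) (l : Fin L) :
    0 < (node l).nodeDrift lam i := by
  unfold LocalNode.nodeDrift
  split_ifs
  · linarith
  · have := (ENNReal.ofReal_le_iff_le_toReal (hfinite l)).1 (hclass l)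
    linarith

variable {node} in
theorem Dtot_pos (hL : 0 < L) {lam : ℝ} (hd : ∀ i l, 0 < (node l).nodeDrift lam i) (i : Fin 2) :
    0 < Dtot node lam i := by
  rw [Dtot_eq_sum]
  exact Finset.sum_pos (fun l _ => hd i l) ⟨⟨0, hL⟩, Finset.mem_univ _⟩

section Transmission

variable {node} {lam c : ℝ} (hL : 0 < L) (hd : ∀ i l, 0 < (node l).nodeDrift lam i)
  (hc : 0 < |Real.log c|)

include hL hd hc

theorem lowerThreshold_neg : lowerThreshold node lam c < 0 := by
  have h0 := Dtot_pos hL hd 0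
  have h1 : 0 < lam / 2 := hd 0 ⟨0, hL⟩
  exact neg_neg_of_pos (by positivity)

theorem upperThreshold_pos (l : Fin L) : 0 < upperThreshold node lam c l := by
  have h0 := Dtot_pos hL hd 1
  have h1 : 0 < (node l).divergence.toReal - lam / 2 := hd 1 l
  unfold upperThreshold
  positivity

/-- Both local thresholds have the form ± `nodeDrift` / `Dtot` · |log c|, which makes the crossing
times of all nodes agree asymptotically. The opposite decision is excluded because 0 separates the
thresholds. -/
theorem transmission_eq_b {i : Fin 2} {l : Fin L} {n : ℕ} {x : ℕ → 𝒳 l}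
    (h : (node l).nodeDrift lam i / Dtot node lam i * |Real.log c| ≤
      hypSign i * (node l).statistic lam n x) :
    transmission node fc lam c l n x = fc.b i := by
  have hlo := lowerThreshold_neg hL hd hc
  have hup := upperThreshold_pos hL hd hc l
  unfold transmission
  rcases (show i = 0 ∨ i = 1 by omega) with rfl | rfl
  · have h1 : (node l).statistic lam n x ≤ lowerThreshold node lam c := by
      simp only [LocalNode.nodeDrift, hypSign, if_true] at h
      unfold lowerThreshold; linarith
    rw [if_neg (by linarith), if_pos h1, zero_add]
  · have h1 : upperThreshold node lam c l ≤ (node l).statistic lam n x := by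
      simp only [LocalNode.nodeDrift, hypSign, one_ne_zero, if_false, one_mul] at h
      exact h
    rw [if_pos h1, if_neg (by linarith), add_zero]

theorem transmission_eq_zero {i : Fin 2} {l : Fin L} {n : ℕ} {x : ℕ → 𝒳 l}
    (h0 : 0 < hypSign i * (node l).statistic lam n x)
    (h : hypSign i * (node l).statistic lam n x <
      (node l).nodeDrift lam i / Dtot node lam i * |Real.log c|) :
    transmission node fc lam c l n x = 0 := by
  have hlo := lowerThreshold_neg hL hd hc
  have hup := upperThreshold_pos hL hd hc l
  unfold transmission
  rcases (show i = 0 ∨ i = 1 by omega) with rfl | rfl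
  · simp only [LocalNode.nodeDrift, hypSign, if_true] at h h0
    have h1 : ¬ (node l).statistic lam n x ≤ lowerThreshold node lam c := by
      unfold lowerThreshold; linarith
    rw [if_neg (by linarith), if_neg h1, zero_add]
  · simp only [LocalNode.nodeDrift, hypSign, one_ne_zero, if_false, one_mul] at h h0
    have h1 : ¬ upperThreshold node lam c l ≤ (node l).statistic lam n x := not_le.2 h
    rw [if_neg h1, if_neg (by linarith), add_zero]

/-- As 0 separates the thresholds, no node sends both values, so the two counts add up to at most
`L`. -/
theorem sum_transmission_mem (n : ℕ) (x : (l : Fin L) → ℕ → 𝒳 l) :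
    ∑ l, transmission node fc lam c l n (x l) ∈ fc.sumValues L := by
  classical
  have hlo := lowerThreshold_neg hL hd hc
  rw [fc.mem_sumValues]
  refine ⟨(Finset.univ.filter fun l =>
    upperThreshold node lam c l ≤ (node l).statistic lam n (x l)).card,
    (Finset.univ.filter fun l =>
    (node l).statistic lam n (x l) ≤ lowerThreshold node lam c).card, ?_, ?_⟩
  · rw [← Finset.card_union_of_disjoint]
    · exact (Finset.card_le_univ _).trans (by simp)
    · refine Finset.disjoint_filter.2 fun l _ h1 h2 => ?_
      linarith [upperThreshold_pos hL hd hc l]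
  · simp only [transmission, Finset.sum_add_distrib, Finset.sum_ite, Finset.sum_const,
      nsmul_eq_mul, smul_zero, add_zero]

end Transmission

theorem measurable_transmission [∀ l, Countable (A l)] [∀ l, DiscreteMeasurableSpace (A l)]
    (lam c : ℝ) (l : Fin L) (n : ℕ) : Measurable (transmission node fc lam c l n) := by
  have h := (node l).measurable_statistic lam n
  unfold transmission
  exact (Measurable.ite (measurableSet_le measurable_const h) measurable_const
    measurable_const).add (Measurable.ite (measurableSet_le h measurable_const)
    measurable_const measurable_const)

/-- Stated on the joint observation process, so that the channel input factors through a variable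
independent of the noise. -/
theorem measurable_sum_transmission [∀ l, Countable (A l)] [∀ l, DiscreteMeasurableSpace (A l)]
    (lam c : ℝ) (n : ℕ) : Measurable fun u : (p : Fin L × ℕ) → 𝒳 p.1 =>
      ∑ l, transmission node fc lam c l n (fun k => u (l, k)) := by
  refine Finset.measurable_fun_sum _ fun l _ => ?_
  have h : Measurable fun (u : (p : Fin L × ℕ) → 𝒳 p.1) (k : ℕ) => (u (l, k) : 𝒳 l) := by
    refine measurable_pi_lambda _ fun k => ?_
    exact measurable_pi_apply (X := fun p : Fin L × ℕ => 𝒳 p.1) (l, k)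
  exact (measurable_transmission node fc lam c l n).comp h

/-- The stopping time is at most any time at which the signed statistic exceeds `|log c|`. -/
theorem stoppingTime_le {lam c : ℝ} {i : Fin 2} {x : (l : Fin L) → ℕ → 𝒳 l} {z : ℕ → ℝ} {n : ℕ}
    (h : |Real.log c| ≤ ∑ k ∈ Finset.range n,
      fc.signedLlr i (∑ l, transmission node fc lam c l (k + 1) (x l) + z k)) :
    stoppingTime node fc lam c x z ≤ n := by
  refine iInf₂_le n fun hmem => ?_
  have h1 : ∑ k ∈ Finset.range n,
      fc.signedLlr i (∑ l, transmission node fc lam c l (k + 1) (x l) + z k) =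
      hypSign i * fcStatistic node fc lam c x z n := by
    rw [fcStatistic, Finset.mul_sum]; rfl
  rw [h1] at h
  obtain ⟨h2, h3⟩ := hmem
  unfold hypSign at h
  split_ifs at h <;> linarith

/-- The sign in C_i moves to the drift, giving a single form for both hypotheses. -/
theorem bound_eq (lam : ℝ) (i : Fin 2) :
    bound node fc lam i = 1 / Dtot node lam i +
      (1 + (∫ z, |fc.wrongIncrement L i z| ∂fc.noise) / Dtot node lam i) /
        (hypSign i * fc.drift L i) := by
  unfold bound C hypSign
  split_ifs
  · rw [neg_one_mul, neg_one_mul, neg_div, div_neg]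
  · rw [one_mul, one_mul]

/-! ### Bounds on the stopping time under H_i -/

section Model

variable {node fc} {i : Fin 2} {Ω : Type*} [MeasurableSpace Ω] {P : Measure Ω}
  {X : (l : Fin L) → ℕ → Ω → 𝒳 l} {Z : ℕ → Ω → ℝ}

theorem Model.indep_node (h : Model node fc i P X Z) (l : Fin L) : iIndepFun (X l) P :=
  h.indep_X.precomp (g := fun k : ℕ => (l, k)) fun _ _ hab => (Prod.ext_iff.1 hab).2

/-- The strong law of large numbers for functions of the noise. -/
theorem Model.ae_tendsto_noise (h : Model node fc i P X Z) {ψ : ℝ → ℝ} (hψ : Measurable ψ)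
    (hint : Integrable ψ fc.noise) :
    ∀ᵐ ω ∂P, Tendsto (fun n : ℕ => (∑ k ∈ Finset.range n, ψ (Z k ω)) / n) atTop
      (𝓝 (∫ z, ψ z ∂fc.noise)) := by
  have h0 : Integrable (fun ω => ψ (Z 0 ω)) P := by
    rw [← h.law_Z 0] at hint
    exact hint.comp_measurable (h.measurable_Z 0)
  have := strong_law_ae_real (fun k ω => ψ (Z k ω)) h0
    (fun j k hjk => (h.indep_Z.comp (fun _ => ψ) (fun _ => hψ)).indepFun hjk)
    (fun k => IdentDistrib.comp ⟨(h.measurable_Z k).aemeasurable, (h.measurable_Z 0).aemeasurable,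
      by rw [h.law_Z, h.law_Z]⟩ hψ)
  rwa [← integral_map (h.measurable_Z 0).aemeasurable hψ.aestronglyMeasurable, h.law_Z] at this

variable [IsProbabilityMeasure P] [∀ l, Countable (A l)] [∀ l, DiscreteMeasurableSpace (A l)]
  {lam : ℝ}

/-- The almost sure asymptotic bound on the stopping time. -/
theorem ae_limsup_stoppingTime_le (hL : 0 < L) (hd : ∀ i l, 0 < (node l).nodeDrift lam i)
    (hfinite : ∀ l, (node l).divergence ≠ ∞) (hmodel : Model node fc i P X Z)
    (hint : ∀ j k : ℕ, j + k ≤ L →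
      Integrable (fun z => fc.llr (j * fc.b 1 + k * fc.b 0 + z)) fc.noise)
    (hworst : fc.WrongIsWorst L i) (hΔ : 0 < hypSign i * fc.drift L i)
    (hdev : ∀ l, ∀ ε : ℝ, 0 < ε →
      ∫⁻ ω, (((node l).lastDeviation i ε (fun k => X l k ω) : ℕ∞) : ℝ≥0∞) ∂P < ∞) :
    ∀ᵐ ω ∂P, limsup (fun c : ℝ =>
        ((stoppingTime node fc lam c (fun l k => X l k ω) (fun k => Z k ω) : ℕ∞) : ℝ≥0∞) /
          ENNReal.ofReal |Real.log c|) (𝓝[>] 0) ≤ ENNReal.ofReal (bound node fc lam i) := by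
  have hD := Dtot_pos hL hd i
  have hmeas : ∀ s, Measurable fun z => fc.signedLlr i (s + z) := fun s =>
    (fc.measurable_signedLlr i).comp (measurable_const_add s)
  have hI := fun s hs => fc.integrable_signedLlr (L := L) i hint (s := s) hs
  have hstat : ∀ᵐ ω ∂P, ∀ l, Tendsto
      (fun n : ℕ => hypSign i * (node l).statistic lam n (fun k => X l k ω) / n) atTop
      (𝓝 ((node l).nodeDrift lam i)) :=
    ae_all_iff.2 fun l => (node l).ae_tendsto_statistic (hmodel.measurable_X l)
      (hmodel.indep_node l) (hmodel.law_X l) (hfinite l) lam (hdev l)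
  filter_upwards [hstat,
    hmodel.ae_tendsto_noise (hmeas 0) (hI 0 (fc.zero_mem_sumValues L)),
    hmodel.ae_tendsto_noise (hmeas (L * fc.b i)) (hI _ (fc.mul_b_mem_sumValues L i)),
    hmodel.ae_tendsto_noise (ψ := fun z => ∑ s ∈ fc.sumValues L, |fc.signedLlr i (s + z)|)
      (Finset.measurable_fun_sum _ fun s _ => by simpa using (hmeas s).norm)
      (integrable_finsetSum _ fun s hs => (hI s hs).abs)] with ω hω h0 h1 hΨ
  refine limsup_le_ofReal fun β hβ => ?_
  rw [bound_eq] at hβ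
  -- The level `a` serves as parameter through `c = exp (-a)`; near 0 every `c` has this form with
  -- `a = |log c|`.
  have hlogexp : ∀ a : ℝ, 0 < a → |Real.log (Real.exp (-a))| = a := fun a ha => by
    rw [Real.log_exp, abs_neg, abs_of_pos ha]
  have key := eventually_le_sum_floor (φ := fc.signedLlr i) (S := fc.sumValues L)
    (s₀ := L * fc.b i) (z := fun k => Z k ω) (D := Dtot node lam i)
    (T := fun a k => ∑ l, transmission node fc lam (Real.exp (-a)) l (k + 1)
      (fun k => X l k ω)) (fc.zero_mem_sumValues L) (fc.mul_b_mem_sumValues L i)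
    (fun a ha k => sum_transmission_mem fc hL hd (by rwa [hlogexp a ha]) _
      (fun l k => X l k ω)) hD
    (by rw [fc.integral_signedLlr]; exact hΔ)
    (fc.neg_integral_abs_wrongIncrement_le hworst (fc.zero_mem_sumValues L))
    (integral_nonneg fun _ => abs_nonneg _) h0 h1 hΨ ?_
    (by rw [fc.integral_signedLlr]; exact hβ)
  · filter_upwards [tendsto_abs_log_nhdsGT_zero.eventually key,
      tendsto_abs_log_nhdsGT_zero.eventually (eventually_gt_atTop 0), self_mem_nhdsWithin,
      nhdsWithin_le_nhds (gt_mem_nhds one_pos)] with c hc ha hc0 hc1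
    have hexp : Real.exp (-|Real.log c|) = c := by
      rw [abs_of_neg (Real.log_neg hc0 hc1), neg_neg, Real.exp_log hc0]
    rw [hexp] at hc
    have hst := stoppingTime_le node fc (x := fun l k => X l k ω) (z := fun k => Z k ω) hc
    have hβ0 : 0 < β := by
      refine lt_trans ?_ hβ
      have : 0 ≤ ∫ z, |fc.wrongIncrement L i z| ∂fc.noise := integral_nonneg fun _ => abs_nonneg _
      positivity
    rw [ENNReal.div_le_iff (by simpa using ha) ENNReal.ofReal_ne_top,
      ← ENNReal.ofReal_mul hβ0.le]
    calc _ ≤ (((⌊β * |Real.log c|⌋₊ : ℕ) : ℕ∞) : ℝ≥0∞) := ENat.toENNReal_le.2 hst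
      _ = ENNReal.ofReal (⌊β * |Real.log c|⌋₊ : ℝ) := by
          rw [ENat.toENNReal_coe, ENNReal.ofReal_natCast]
      _ ≤ _ := ENNReal.ofReal_le_ofReal (Nat.floor_le (by positivity))
  · intro η hη0 hη1
    -- These slopes match the window: up to time (1 - η)a / D the upper slope stays below the
    -- threshold `nodeDrift` · a / D, and from (1 + η)a / D on the lower slope has reached it.
    have hev : ∀ᶠ n : ℕ in atTop, ∀ l, (node l).nodeDrift lam i / (1 + η) <
        hypSign i * (node l).statistic lam n (fun k => X l k ω) / n ∧
        hypSign i * (node l).statistic lam n (fun k => X l k ω) / n <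
          (node l).nodeDrift lam i / (1 - η) := by
      refine eventually_all.2 fun l => ?_
      have hp := hd i l
      refine ((hω l).eventually (lt_mem_nhds ?_)).and ((hω l).eventually (gt_mem_nhds ?_))
      · rw [div_lt_iff₀ (by linarith)]; nlinarith
      · rw [lt_div_iff₀ (by linarith)]; nlinarith
    obtain ⟨M, hM⟩ := eventually_atTop.1 hev
    refine ⟨M, fun a ha k hk => ⟨fun hka => ?_, fun hka => ?_⟩⟩
    · refine Finset.sum_eq_zero fun l _ => ?_
      obtain ⟨g1, g2⟩ := hM (k + 1) (by omega) l
      have hk0 : (0 : ℝ) < ((k + 1 : ℕ) : ℝ) := by positivity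
      rw [lt_div_iff₀ hk0] at g1
      rw [div_lt_iff₀ hk0] at g2
      have hp := hd i l
      refine transmission_eq_zero fc hL hd (by rwa [hlogexp a ha]) (lt_trans (by positivity) g1)
        (g2.trans_le ?_)
      rw [hlogexp a ha]
      have hη : 0 < 1 - η := by linarith
      push_cast
      calc (node l).nodeDrift lam i / (1 - η) * ((k : ℝ) + 1)
          ≤ (node l).nodeDrift lam i / (1 - η) * ((1 - η) / Dtot node lam i * a) := by gcongr
        _ = _ := by field_simp
    · rw [Finset.sum_congr rfl fun l _ => transmission_eq_b fc hL hd (i := i)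
        (by rwa [hlogexp a ha]) ?_]
      · simp
      · obtain ⟨g1, g2⟩ := hM (k + 1) (by omega) l
        have hk0 : (0 : ℝ) < ((k + 1 : ℕ) : ℝ) := by positivity
        rw [lt_div_iff₀ hk0] at g1
        have hp := hd i l
        refine le_trans ?_ g1.le
        rw [hlogexp a ha]
        push_cast
        calc _ = (node l).nodeDrift lam i / (1 + η) * ((1 + η) / Dtot node lam i * a) := by
              field_simp
          _ ≤ (node l).nodeDrift lam i / (1 + η) * ((k : ℝ) + 1) := by gcongr

/-- The expected number of times at which not all nodes transmit the correct decision. -/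
theorem exists_sum_measureReal_transmission_le (hL : 0 < L)
    (hd : ∀ i l, 0 < (node l).nodeDrift lam i)
    (hfinite : ∀ l, (node l).divergence ≠ ∞) (hmodel : Model node fc i P X Z)
    (hdev : ∀ l, ∀ ε : ℝ, 0 < ε →
      ∫⁻ ω, (((node l).lastDeviation i ε (fun k => X l k ω) : ℕ∞) : ℝ≥0∞) ∂P < ∞)
    {η : ℝ} (hη : 0 < η) :
    ∃ R : ℝ, ∀ c : ℝ, 0 < |Real.log c| → ∀ n : ℕ,
      ∑ k ∈ Finset.range n, P.real {ω | ∑ l, transmission node fc lam c l (k + 1)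
        (fun k => X l k ω) ≠ L * fc.b i} ≤
      (1 + η) / Dtot node lam i * |Real.log c| + R := by
  have hD := Dtot_pos hL hd i
  -- The comparison slope does not involve `c`, so the remainder `R` is uniform in `c`. Times before
  -- (1 + η)|log c| / D are charged probability 1; later, a wrong sum forces some `B l k`.
  let B : Fin L → ℕ → Set Ω := fun l n =>
    {ω | hypSign i * (node l).statistic lam (n + 1) (fun k => X l k ω) <
      ((n + 1 : ℕ) : ℝ) * ((node l).nodeDrift lam i / (1 + η))}
  have hB : ∀ l, Summable fun n => P.real (B l n) := fun l =>
    (node l).summable_measureReal_statistic (hmodel.measurable_X l)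
      (hmodel.indep_node l) (hmodel.law_X l) (hfinite l) lam (hdev l) (by
        have hp := hd i l
        rw [div_lt_iff₀ (by linarith)]; nlinarith)
  refine ⟨∑ l, ∑' n, P.real (B l n), fun c hc n => ?_⟩
  have hterm : ∀ k, P.real {ω | ∑ l, transmission node fc lam c l (k + 1)
      (fun k => X l k ω) ≠ L * fc.b i} ≤
      (if ((k + 1 : ℕ) : ℝ) < (1 + η) / Dtot node lam i * |Real.log c| then 1 else 0) +
        ∑ l, P.real (B l k) := fun k => by
    by_cases hk : ((k + 1 : ℕ) : ℝ) < (1 + η) / Dtot node lam i * |Real.log c|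
    · rw [if_pos hk]
      have : 0 ≤ ∑ l, P.real (B l k) := Finset.sum_nonneg fun _ _ => measureReal_nonneg
      linarith [measureReal_le_one (μ := P) (s := {ω | ∑ l, transmission node fc lam c l (k + 1)
        (fun k => X l k ω) ≠ L * fc.b i})]
    · rw [if_neg hk, zero_add]
      refine (measureReal_mono ?_).trans (measureReal_iUnion_fintype_le (fun l => B l k))
      intro ω hω
      by_contra hcon
      refine hω ?_
      rw [Finset.sum_congr rfl fun l _ => transmission_eq_b fc hL hd (i := i) hc ?_]
      · simp
      · have h1 : ¬ ω ∈ B l k := fun h => hcon (Set.mem_iUnion.2 ⟨l, h⟩)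
        refine le_trans ?_ (not_lt.1 h1)
        have hp := hd i l
        calc _ = ((1 + η) / Dtot node lam i * |Real.log c|) *
              ((node l).nodeDrift lam i / (1 + η)) := by field_simp
          _ ≤ _ := by gcongr; exact not_lt.1 hk
  refine (Finset.sum_le_sum fun k _ => hterm k).trans ?_
  rw [Finset.sum_add_distrib, Finset.sum_comm]
  refine add_le_add ?_ (Finset.sum_le_sum fun l _ =>
    (hB l).sum_le_tsum _ fun _ _ => measureReal_nonneg)
  rw [← Finset.sum_filter, Finset.sum_const, nsmul_eq_mul, mul_one]
  exact card_filter_lt_le n (by positivity)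

/-- A bound on the expected stopping time in terms of the means of the increments truncated at `K`
and of the expected number `Q` of times at which not all nodes transmit the correct decision. -/
theorem lintegral_stoppingTime_le (hL : 0 < L) (hd : ∀ i l, 0 < (node l).nodeDrift lam i)
    (hmodel : Model node fc i P X Z) {c K d θ Q : ℝ} (hc : 0 < |Real.log c|) (hK : 0 ≤ K)
    (hd0 : 0 < d)
    (hint : ∀ s ∈ fc.sumValues L, Integrable (fun z => min (fc.signedLlr i (s + z)) K) fc.noise)
    (hθ : ∀ s ∈ fc.sumValues L, -θ ≤ ∫ z, min (fc.signedLlr i (s + z)) K ∂fc.noise)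
    (hdK : d ≤ ∫ z, min (fc.signedLlr i (L * fc.b i + z)) K ∂fc.noise)
    (hQ : ∀ n : ℕ, ∑ k ∈ Finset.range n, P.real {ω | ∑ l, transmission node fc lam c l (k + 1)
        (fun k => X l k ω) ≠ L * fc.b i} ≤ Q) :
    ∫⁻ ω, ((stoppingTime node fc lam c (fun l k => X l k ω) (fun k => Z k ω) : ℕ∞) : ℝ≥0∞) ∂P ≤
      ENNReal.ofReal ((|Real.log c| + K + |d + θ| * Q) / d) := by
  let φ : ℝ → ℝ := fun y => min (fc.signedLlr i y) K
  have hφ : Measurable φ := (fc.measurable_signedLlr i).min measurable_const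
  let U : Ω → ((p : Fin L × ℕ) → 𝒳 p.1) := fun ω p => X p.1 p.2 ω
  have hU : Measurable U := measurable_pi_lambda _ fun p => hmodel.measurable_X p.1 p.2
  let T : ℕ → Ω → ℝ := fun n ω => ∑ l, transmission node fc lam c l (n + 1) (fun k => X l k ω)
  have hTU : ∀ n, Measurable[MeasurableSpace.comap U MeasurableSpace.pi] (T n) := fun n => by
    have h1 := measurable_sum_transmission node fc lam c (n + 1)
    have h2 : T n = (fun u : (p : Fin L × ℕ) → 𝒳 p.1 =>
      ∑ l, transmission node fc lam c l (n + 1) (fun k => u (l, k))) ∘ U := rfl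
    rw [h2]
    exact h1.comp (comap_measurable U)
  have hTS : ∀ n ω, T n ω ∈ fc.sumValues L := fun n ω =>
    sum_transmission_mem fc hL hd hc (n + 1) (fun l k => X l k ω)
  have hTm : ∀ n, Measurable (T n) := fun n => (hTU n).mono hU.comap_le le_rfl
  have hA := measurableSet_belowEvent hφ hTm hmodel.measurable_Z |Real.log c|
  have hsum : ∀ n, ∑ k ∈ Finset.range n, P.real (belowEvent φ T Z |Real.log c| k) ≤
      (|Real.log c| + K + |d + θ| * Q) / d := fun n => by
    have h1 := sum_measureReal_belowEvent_le (T := T) (φ := φ) hU hmodel.measurable_Z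
      hmodel.indep_Z hmodel.indep_XZ hmodel.law_Z hTU hTS hφ hint hc.le hK
      (fun y => min_le_right _ _) hθ hdK n
    have h2 := mul_le_mul_of_nonneg_left (hQ n) (abs_nonneg (d + θ))
    rw [le_div_iff₀ hd0, mul_comm]
    linarith
  calc _ ≤ ∫⁻ ω, ∑' k, (belowEvent φ T Z |Real.log c| k).indicator 1 ω ∂P := by
        refine lintegral_mono fun ω => toENNReal_le_tsum_belowEvent fun j hj => ?_
        -- The truncated walk lies below the signed one, so its passage time can only be later.
        exact stoppingTime_le node fc (i := i) (hj.trans (Finset.sum_le_sum fun k _ =>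
          min_le_left _ _))
    _ = ∑' k, P (belowEvent φ T Z |Real.log c| k) := by
        rw [lintegral_tsum fun k => (measurable_one.indicator (hA k)).aemeasurable]
        exact tsum_congr fun k => lintegral_indicator_one (hA k)
    _ ≤ _ := by
        refine ENNReal.tsum_le_of_sum_range_le fun n => ?_
        rw [← ENNReal.ofReal_toReal (a := ∑ k ∈ Finset.range n, _)
          (ENNReal.sum_ne_top.2 fun _ _ => measure_ne_top _ _),
          ENNReal.toReal_sum fun _ _ => measure_ne_top _ _]
        exact ENNReal.ofReal_le_ofReal (hsum n)

/-- The asymptotic bound on the expected stopping time. -/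
theorem limsup_lintegral_stoppingTime_le (hL : 0 < L) (hd : ∀ i l, 0 < (node l).nodeDrift lam i)
    (hfinite : ∀ l, (node l).divergence ≠ ∞) (hmodel : Model node fc i P X Z)
    (hint : ∀ j k : ℕ, j + k ≤ L →
      Integrable (fun z => fc.llr (j * fc.b 1 + k * fc.b 0 + z)) fc.noise)
    (hworst : fc.WrongIsWorst L i) (hΔ : 0 < hypSign i * fc.drift L i)
    (hdev : ∀ l, ∀ ε : ℝ, 0 < ε →
      ∫⁻ ω, (((node l).lastDeviation i ε (fun k => X l k ω) : ℕ∞) : ℝ≥0∞) ∂P < ∞) :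
    limsup (fun c : ℝ => (∫⁻ ω, ((stoppingTime node fc lam c (fun l k => X l k ω)
        (fun k => Z k ω) : ℕ∞) : ℝ≥0∞) ∂P) / ENNReal.ofReal |Real.log c|) (𝓝[>] 0) ≤
      ENNReal.ofReal (bound node fc lam i) := by
  refine limsup_le_ofReal fun β hβ => ?_
  rw [bound_eq] at hβ
  have hD := Dtot_pos hL hd i
  set D := Dtot node lam i with hDdef
  set Δ := hypSign i * fc.drift L i with hΔdef
  set θ := ∫ z, |fc.wrongIncrement L i z| ∂fc.noise with hθdef
  have hθ : 0 ≤ θ := integral_nonneg fun _ => abs_nonneg _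
  obtain ⟨ε, hε0, hεΔ, hε⟩ : ∃ ε : ℝ, 0 < ε ∧ ε < Δ ∧
      (1 + (Δ + θ) * ((1 + ε) / D)) / (Δ - ε) < β := by
    have hc : ContinuousAt (fun ε : ℝ => (1 + (Δ + θ) * ((1 + ε) / D)) / (Δ - ε)) 0 :=
      ContinuousAt.div (by fun_prop) (by fun_prop) (by simpa using hΔ.ne')
    -- At ε = 0 the quotient is (1 + (Δ + θ) / D) / Δ = 1 / D + (1 + θ / D) / Δ.
    have e1 := hc.eventually (gt_mem_nhds (a := β) (by
      refine lt_of_eq_of_lt ?_ hβ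
      simp only [sub_zero, add_zero]; field_simp; ring))
    have e : ∀ᶠ ε : ℝ in 𝓝[>] 0, 0 < ε ∧ ε < Δ ∧
        (1 + (Δ + θ) * ((1 + ε) / D)) / (Δ - ε) < β := by
      filter_upwards [self_mem_nhdsWithin, nhdsWithin_le_nhds e1,
        nhdsWithin_le_nhds (gt_mem_nhds hΔ)] with ε a b c
      exact ⟨a, c, b⟩
    exact e.exists
  obtain ⟨K, hK0, hK⟩ := exists_truncation (fc.sumValues L) (fc.measurable_signedLlr i)
    (fun s hs => fc.integrable_signedLlr i hint hs) hε0
  obtain ⟨R, hR⟩ := exists_sum_measureReal_transmission_le hL hd hfinite hmodel hdev hε0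
  have hdε : 0 < Δ - ε := by linarith
  let H : ℝ → ℝ := fun a => (a + K + (Δ + θ) * ((1 + ε) / D * a + R)) / (Δ - ε)
  have hmain : ∀ c : ℝ, 0 < |Real.log c| →
      ∫⁻ ω, ((stoppingTime node fc lam c (fun l k => X l k ω) (fun k => Z k ω) : ℕ∞) : ℝ≥0∞) ∂P ≤
        ENNReal.ofReal (H |Real.log c|) := by
    intro c hc
    -- Truncation lowers each mean by at most ε: the drift becomes Δ - ε and the loss θ + ε, with
    -- unchanged sum Δ + θ.
    have h1 := lintegral_stoppingTime_le (θ := θ + ε) hL hd hmodel hc hK0 hdε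
      (fun s hs => (hK s hs).1)
      (fun s hs => by
        have := fc.neg_integral_abs_wrongIncrement_le hworst hs
        linarith [(hK s hs).2])
      (by
        have := (hK _ (fc.mul_b_mem_sumValues L i)).2
        rwa [fc.integral_signedLlr] at this) (hR c hc)
    rwa [show Δ - ε + (θ + ε) = Δ + θ by ring, abs_of_pos (by linarith : 0 < Δ + θ)] at h1
  have hlim : Tendsto (fun a : ℝ => (1 + (Δ + θ) * ((1 + ε) / D)) / (Δ - ε) +
      ((K + (Δ + θ) * R) / (Δ - ε)) / a) atTop
      (𝓝 ((1 + (Δ + θ) * ((1 + ε) / D)) / (Δ - ε) + 0)) :=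
    tendsto_const_nhds.add (tendsto_const_nhds.div_atTop tendsto_id)
  rw [add_zero] at hlim
  filter_upwards [tendsto_abs_log_nhdsGT_zero.eventually (hlim.eventually (gt_mem_nhds hε)),
    tendsto_abs_log_nhdsGT_zero.eventually (eventually_gt_atTop 0)] with c hc hc0
  have hβ0 : 0 < β := by
    refine lt_trans ?_ hβ
    positivity
  rw [ENNReal.div_le_iff (by simpa using hc0) ENNReal.ofReal_ne_top, ← ENNReal.ofReal_mul hβ0.le]
  refine (hmain c hc0).trans (ENNReal.ofReal_le_ofReal ?_)
  have h1 : H |Real.log c| = ((1 + (Δ + θ) * ((1 + ε) / D)) / (Δ - ε) +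
      ((K + (Δ + θ) * R) / (Δ - ε)) / |Real.log c|) * |Real.log c| := by
    have := hdε.ne'
    simp only [H]
    field_simp
    ring
  rw [h1]
  exact mul_le_mul_of_nonneg_right hc.le hc0.le

end Model

end DecentralizedTest

theorem mainTheorem3 {L : ℕ} (hL : 0 < L) {𝒳 : Fin L → Type*} {A : Fin L → Type*}
    [∀ l, MeasurableSpace (𝒳 l)] [∀ l, MeasurableSpace (A l)]
    [∀ l, Countable (A l)] [∀ l, DiscreteMeasurableSpace (A l)]
    (node : (l : Fin L) → LocalNode (𝒳 l) (A l)) (fc : FusionCenter)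
    (lam : ℝ) (hlam : 0 < lam)
    (hclass : ∀ l, ENNReal.ofReal lam ≤ (node l).divergence)
    (hfinite : ∀ l, (node l).divergence ≠ ∞)
    (i : Fin 2)
    {Ω : Type*} [MeasurableSpace Ω] (P : Measure Ω) [IsProbabilityMeasure P]
    (X : (l : Fin L) → ℕ → Ω → 𝒳 l) (Z : ℕ → Ω → ℝ)
    (hmodel : DecentralizedTest.Model node fc i P X Z)
    (hint : ∀ j k : ℕ, j + k ≤ L →
      Integrable (fun z => fc.llr (j * fc.b 1 + k * fc.b 0 + z)) fc.noise)
    (hworst : fc.WrongIsWorst L i)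
    (hdrift : (i = 0 → fc.drift L i < 0) ∧ (i = 1 → 0 < fc.drift L i))
    (α : ℝ) (hα : 1 < α)
    (hdev : ∀ l, ∀ ε : ℝ, 0 < ε →
      ∫⁻ ω, (((node l).lastDeviation i ε (fun k => X l k ω) : ℕ∞) : ℝ≥0∞) ∂P < ∞)
    (hllr : ∀ l, Integrable
      (fun x => |Real.log ((node l).f 1 x / (node l).f 0 x)| ^ (α + 1)) ((node l).law i))
    (hxi : Integrable (fun z => |fc.wrongIncrement L i z| ^ (α + 1)) fc.noise) :
    (∀ᵐ ω ∂P,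
      limsup (fun c : ℝ =>
        ((DecentralizedTest.stoppingTime node fc lam c (fun l k => X l k ω) (fun k => Z k ω) : ℕ∞)
          : ℝ≥0∞) / ENNReal.ofReal |Real.log c|) (𝓝[>] 0)
        ≤ ENNReal.ofReal (DecentralizedTest.bound node fc lam i)) ∧
    limsup (fun c : ℝ =>
        (∫⁻ ω, ((DecentralizedTest.stoppingTime node fc lam c (fun l k => X l k ω)
          (fun k => Z k ω) : ℕ∞) : ℝ≥0∞) ∂P) / ENNReal.ofReal |Real.log c|) (𝓝[>] 0)
      ≤ ENNReal.ofReal (DecentralizedTest.bound node fc lam i) := by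
  have hd : ∀ i l, 0 < (node l).nodeDrift lam i := fun i l =>
    DecentralizedTest.nodeDrift_pos hlam hclass hfinite i l
  have hΔ : 0 < hypSign i * fc.drift L i := by
    rcases (show i = 0 ∨ i = 1 by omega) with hi | hi
    · have := hdrift.1 hi
      rw [hypSign, if_pos hi]; linarith
    · have := hdrift.2 hi
      rw [hypSign, if_neg (by omega)]; linarith
  exact ⟨DecentralizedTest.ae_limsup_stoppingTime_le hL hd hfinite hmodel hint hworst hΔ hdev,
    DecentralizedTest.limsup_lintegral_stoppingTime_le hL hd hfinite hmodel hint hworst hΔ hdev⟩
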